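/- **Theorem.** *Setting.* There are $K\ge 1$ arms. Arm $i$ is a Markov chain on a finite set $S^i$ with transition matrix $P^i=(p^i_{xy})$, which is irreducible, aperiodic and reversible with respect to its stationary distribution $\pi^i$ ($\pi^i_x p^i_{xy}=\pi^i_y p^i_{yx}$). State $x$ of arm $i$ carries a reward $r^i_x>0$. The chains are mutually independent, with arbitrary initial distributions, and are rested: an arm moves only when it is played, i.e. the $m$-th play of arm $i$ shows the $m$-th state of its chain. Let $\mu^i=\sum_{x\in S^i} r^i_x\pi^i_x$ and $\mu^*=\max_i\mu^i$, and let the superscript $*$ denote any arm with mean $\mu^*$. If $\alpha(t)$ is the arm played at time $t$ and $x_{\alpha(t)}$ the state it shows, the regret at time $n$ is $$R(n)=n\mu^*-E\Big[\sum_{t=1}^n r^{\alpha(t)}_{x_{\alpha(t)}}\Big].$$ Let $\epsilon^i=1-\lambda_2(P^i)$ be the eigenvalue gap, where $\lambda_2(P^i)$ is the second largest eigenvalue of $P^i$ (with $\epsilon^i=1$ if $|S^i|=1$), and put $\pi_{\min}=\min_{i,x}\pi^i_x$, $r_{\max}=\max_{i,x}r^i_x$, $r_{\min}=\min_{i,x}r^i_x$,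 $S_{\max}=\max_i|S^i|$, $\epsilon_{\max}=\max_i\epsilon^i$, $\epsilon_{\min}=\min_i\epsilon^i$. *Policy.* The UCB policy with exploration constant $L$ plays arms $1,\dots,K$ once each, in this order, at times $1,\dots,K$. At each time $t>K$ it plays an arm $i$ with the highest index $\bar r^i+\sqrt{L\ln t/T^i}$, where $T^i$ is the number of plays of arm $i$ and $\bar r^i$ the mean of the rewards received from it, both before time $t$; ties are broken by any rule depending only on the past observations. The result below holds equally if $\ln t$ is replaced by $\ln(t-1)$ in all indices. *Claim.* There is a constant $C_{\mathbf{S,P,r}}$ depending only on the state spaces, transition matrices and rewards of the arms, such that for every $L\ge 90\,S_{\max}^2r_{\max}^2/\epsilon_{\min}$ the regret of the UCB policy satisfies, for all $n\ge1$, $$R(n)\le 4L\sum_{i:\mu^i<\mu^*}\frac{\ln n}{\mu^*-\mu^i}+\sum_{i:\mu^i<\mu^*}(\mu^*-\mu^i)\,C^i+C_{\mathbf{S,P,r}},$$ where $$C^i=1+(D^i+D^*)\beta,\qquad D^i=\frac{|S^i|}{\pi_{\min}}\Big(1+\frac{\epsilon_{\max}\sqrt L}{10\,|S^i|\,r_{\min}}\Big),\qquad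 \beta=\sum_{t=1}^\infty t^{-2}.$$ -/

import Mathlib

open MeasureTheory ProbabilityTheory

namespace RestedBandit

/-! ### Finite Markov chains -/

section Chains

variable {S : Type*} [Fintype S] [DecidableEq S]

/-- `P` is aperiodic: for every state `x` the greatest common divisor of the possible
return times `{n ≥ 1 | (P ^ n) x x > 0}` is `1`. -/
def IsAperiodic (P : Matrix S S ℝ) : Prop :=
  ∀ x : S, ∀ d : ℕ, (∀ n : ℕ, 0 < n → 0 < (P ^ n) x x → d ∣ n) → d = 1

/-- `p` is a stationary distribution of `P`: a probability vector with `p P = p`. -/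
def IsStationary (P : Matrix S S ℝ) (p : S → ℝ) : Prop :=
  p ∈ stdSimplex ℝ S ∧ Matrix.vecMul p P = p

/-- `P` is reversible with respect to `p` (detailed balance). -/
def IsReversible (P : Matrix S S ℝ) (p : S → ℝ) : Prop :=
  ∀ x y : S, p x * P x y = p y * P y x

/-- The second largest eigenvalue of `P`. The largest eigenvalue of a stochastic matrix is `1`,
and it is simple if the matrix is irreducible, so this is the largest eigenvalue other than `1`.
(For a chain with a single state there is no further eigenvalue and the value is `0`.) -/
noncomputable def secondEigenvalue (P : Matrix S S ℝ) : ℝ :=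
  sSup {l : ℝ | l ≠ 1 ∧ Module.End.HasEigenvalue (Matrix.toLin' P) l}

/-- The eigenvalue gap of `P` (equal to `1` for a chain with a single state). -/
noncomputable def spectralGap (P : Matrix S S ℝ) : ℝ := 1 - secondEigenvalue P

/-- Under the probability `Pr`, the process `X 0, X 1, …` is a Markov chain with initial
distribution `q` and transition matrix `P`. -/
structure IsMarkovChain {Ω : Type*} [MeasurableSpace Ω] [MeasurableSpace S]
    (Pr : Measure Ω) (q : S → ℝ) (P : Matrix S S ℝ) (X : ℕ → Ω → S) : Prop where
  measurable : ∀ n, Measurable (X n)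
  path_prob : ∀ (n : ℕ) (x : ℕ → S),
    Pr.real {ω | ∀ k ≤ n, X k ω = x k} = q (x 0) * ∏ k ∈ Finset.range n, P (x k) (x (k + 1))

end Chains

/-! ### Policies and their runs on rested arms -/

section Policies

variable {K : ℕ} {S : Fin K → Type*}

/-- What has been observed so far, oldest first: the arms played and the states they showed. -/
abbrev History (S : Fin K → Type*) : Type _ := List (Σ i : Fin K, S i)

/-- A policy chooses the next arm from the history. -/
abbrev Policy (S : Fin K → Type*) : Type _ := History S → Fin K

/-- The number of times arm `i` has been played in the history `h`. -/
def plays (h : History S) (i : Fin K) : ℕ := h.countP (fun e => e.1 = i)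

/-- The total reward collected in `h`, where `r i x` is the reward of state `x` of arm `i`. -/
noncomputable def totalReward (r : ∀ i, S i → ℝ) (h : History S) : ℝ :=
  (h.map fun e => r e.1 e.2).sum

/-- The sample mean of the rewards collected from arm `i` in `h`. -/
noncomputable def sampleMean (r : ∀ i, S i → ℝ) (h : History S) (i : Fin K) : ℝ :=
  (h.map fun e => if e.1 = i then r e.1 e.2 else 0).sum / (plays h i : ℝ)

/-- The UCB index of arm `i`, at clock value `n`, after the history `h`. -/
noncomputable def ucbIndex (r : ∀ i, S i → ℝ) (L : ℝ) (n : ℕ) (h : History S) (i : Fin K) : ℝ :=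
  sampleMean r h i + Real.sqrt (L * Real.log n / (plays h i : ℝ))

/-- `α` is a UCB policy with exploration constant `L`: the first `K` plays are
the arms `1, …, K` in this order, and each later play is of an arm of highest index (ties are
broken in any way that depends only on the history). The play that follows `h` is the play
number `h.length + 1`, and the clock of the index then shows `h.length + d`: for `d = 1` it is
the number of the play that is about to be made, for `d = 0` the number of completed plays. -/
def IsUCB (r : ∀ i, S i → ℝ) (L : ℝ) (d : ℕ) (α : Policy S) : Prop :=
  (∀ (h : History S) (hlt : h.length < K), α h = ⟨h.length, hlt⟩) ∧
  (∀ h : History S, K ≤ h.length →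
    ∀ j : Fin K, ucbIndex r L (h.length + d) h j ≤ ucbIndex r L (h.length + d) h (α h))

/-- The history after `n` plays when `α` is run on rested arms: `x i m` is the state that arm `i`
shows when it is played for the `(m + 1)`-st time, so an arm moves only when it is played. -/
def run (α : Policy S) (x : ∀ i, ℕ → S i) : ℕ → History S
  | 0 => []
  | n + 1 =>
    run α x n ++ [⟨α (run α x n), x (α (run α x n)) (plays (run α x n) (α (run α x n)))⟩]

/-- The mean reward of arm `i` under its stationary distribution `p i`. -/
noncomputable def meanReward [∀ i, Fintype (S i)] (r p : ∀ i, S i → ℝ) (i : Fin K) : ℝ :=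
  ∑ x, r i x * p i x

/-- The largest mean reward of an arm. -/
noncomputable def bestMean [∀ i, Fintype (S i)] (r p : ∀ i, S i → ℝ) : ℝ :=
  ⨆ i, meanReward r p i

/-- The regret of the policy `α` up to time `n`, where `X i m` is the state of arm `i` at its
`(m + 1)`-st play. -/
noncomputable def regret [∀ i, Fintype (S i)] {Ω : Type*} [MeasurableSpace Ω] (Pr : Measure Ω)
    (r p : ∀ i, S i → ℝ) (X : ∀ i, ℕ → Ω → S i) (α : Policy S) (n : ℕ) : ℝ :=
  n * bestMean r p - ∫ ω, totalReward r (run α (fun i m => X i m ω) n) ∂Pr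

end Policies

/-! ### The constants of the bound -/

section Constants

variable {K : ℕ} {S : Fin K → Type*}

/-- The smallest value of `f i x` over all arms `i` and states `x` of `i`. -/
noncomputable def minOver (f : ∀ i, S i → ℝ) : ℝ := ⨅ e : Σ i, S i, f e.1 e.2

/-- The largest value of `f i x` over all arms `i` and states `x` of `i`. -/
noncomputable def maxOver (f : ∀ i, S i → ℝ) : ℝ := ⨆ e : Σ i, S i, f e.1 e.2

variable [∀ i, Fintype (S i)]

/-- The largest number of states of an arm. -/
noncomputable def maxCard (S : Fin K → Type*) [∀ i, Fintype (S i)] : ℝ :=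
  ⨆ i, (Fintype.card (S i) : ℝ)

variable [∀ i, DecidableEq (S i)]

/-- The smallest eigenvalue gap of an arm. -/
noncomputable def gapMin (P : ∀ i, Matrix (S i) (S i) ℝ) : ℝ := ⨅ i, spectralGap (P i)

/-- The largest eigenvalue gap of an arm. -/
noncomputable def gapMax (P : ∀ i, Matrix (S i) (S i) ℝ) : ℝ := ⨆ i, spectralGap (P i)

/-- `D^i = (|S^i| / π_min) (1 + ε_max √L / (10 |S^i| r_min))`. -/
noncomputable def constD (P : ∀ i, Matrix (S i) (S i) ℝ) (r p : ∀ i, S i → ℝ) (L : ℝ)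
    (i : Fin K) : ℝ :=
  (Fintype.card (S i) : ℝ) / minOver p *
    (1 + gapMax P * Real.sqrt L / (10 * (Fintype.card (S i) : ℝ) * minOver r))

/-- `C^i = 1 + (D^i + D^*) β` with `β = ∑_{t ≥ 1} t⁻²`; `best` is the optimal arm. -/
noncomputable def constC (P : ∀ i, Matrix (S i) (S i) ℝ) (r p : ∀ i, S i → ℝ) (L : ℝ)
    (best i : Fin K) : ℝ :=
  1 + (constD P r p L i + constD P r p L best) * ∑' t : ℕ, 1 / ((t : ℝ) + 1) ^ 2

end Constants

end RestedBandit

/-! The regret splits into the expected plays of suboptimal arms and a bounded error. For each arm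
solve the Poisson equation g - P g = r - μ. Since an arm moves only when it is played, the centred
rewards telescope to boundary values of g plus increments g(z) - (P g)(x), which have mean zero
under every policy by the Markov property and the independence of the arms. With Δ_i = μ* - μ^i this
gives R(n) ≤ ∑ Δ_i E[T_i(n)] + 2 ∑ |g| (`regret_le`).

Once a suboptimal arm i has 4 L ln n / Δ_i² plays, its confidence radius is at most Δ_i / 2, so
playing it again forces its sample mean to be too high, or that of the optimal arm too low, by a
full radius (`IsUCB.exists_deviation`). The number of plays is random, so one takes a union over all
counts s ≤ t; each deviation has probability O(t⁻³) (`IsMarkovChain.tail_bound`), which leaves a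
summable t⁻² (`IsUCB.integral_plays_le`).

The tail bound is Chernoff's method for a reversible chain. For F of mean zero with |F| ≤ τ ≤ ε /
15, the operator e^F P is self-adjoint in ℓ²(p e^{-F}), and the Poincaré inequality bounds its norm
by 1 + (15/2) τ² / ε (`tilted_norm_contract`). An arbitrary initial distribution costs only a factor
of order 1 / √p(x).

That factor does not depend on L, so all terms other than the logarithmic one fit into the constant
C; the terms with C^i are needed only to be nonnegative. -/

namespace RestedBandit

/-! ### Irreducible reversible chains -/

section ChainAnalysis

variable {S : Type*} [Fintype S] [DecidableEq S]

/-- `P` is an irreducible stochastic matrix, reversible with respect to its stationary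
distribution `p`. -/
structure IsReversibleChain (P : Matrix S S ℝ) (p : S → ℝ) : Prop where
  stochastic : P ∈ Matrix.rowStochastic ℝ S
  irreducible : P.IsIrreducible
  stationary : IsStationary P p
  reversible : IsReversible P p

namespace IsReversibleChain

variable {P : Matrix S S ℝ} {p : S → ℝ}

lemma nonneg (h : IsReversibleChain P p) (x y : S) : 0 ≤ P x y :=
  Matrix.nonneg_of_mem_rowStochastic h.stochastic

lemma sum_row (h : IsReversibleChain P p) (x : S) : ∑ y, P x y = 1 :=
  Matrix.sum_row_of_mem_rowStochastic h.stochastic x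

lemma sum_stationary (h : IsReversibleChain P p) : ∑ x, p x = 1 := h.stationary.1.2

lemma sum_mul_col (h : IsReversibleChain P p) (y : S) : ∑ x, p x * P x y = p y :=
  congrFun h.stationary.2 y

lemma nonempty (h : IsReversibleChain P p) : Nonempty S := by
  by_contra hS
  rw [not_nonempty_iff] at hS
  simpa using h.sum_stationary

lemma exists_pow_pos (h : IsReversibleChain P p) (x y : S) : ∃ k, 0 < (P ^ k) x y := by
  obtain ⟨k, -, hk⟩ :=
    (Matrix.isIrreducible_iff_exists_pow_pos h.irreducible.1).1 h.irreducible x y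
  exact ⟨k, hk⟩

lemma stationary_pos (h : IsReversibleChain P p) (y : S) : 0 < p y := by
  have hnn : ∀ x, 0 ≤ p x := h.stationary.1.1
  obtain ⟨x, hx⟩ : ∃ x, 0 < p x := by
    by_contra! hle
    have := Finset.sum_nonpos fun x (_ : x ∈ Finset.univ) => hle x
    linarith [h.sum_stationary]
  obtain ⟨k, hk⟩ := h.exists_pow_pos x y
  have hpow : Matrix.vecMul p (P ^ k) = p := by
    clear hk
    induction k with
    | zero => simp
    | succ k ih => rw [pow_succ, ← Matrix.vecMul_vecMul, ih, h.stationary.2]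
  have hk' : ∀ z, 0 ≤ (P ^ k) z y := fun z =>
    Matrix.nonneg_of_mem_rowStochastic (pow_mem h.stochastic k)
  calc 0 < p x * (P ^ k) x y := mul_pos hx hk
    _ ≤ ∑ z, p z * (P ^ k) z y :=
      Finset.single_le_sum (f := fun z => p z * (P ^ k) z y)
        (fun z _ => mul_nonneg (hnn z) (hk' z)) (Finset.mem_univ x)
    _ = p y := congrFun hpow y

/-- Maximum principle: at a maximum point `a`, the value `g a` is an average of `g` with weights `(P
^ k) a`, so `g` equals the maximum at every state of positive weight, and irreducibility reaches all
states. -/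
lemma harmonic_const (h : IsReversibleChain P p) {g : S → ℝ} (hg : P.mulVec g = g) (x y : S) :
    g x = g y := by
  have := h.nonempty
  obtain ⟨a, ha⟩ := Finite.exists_max g
  suffices key : ∀ z, g z = g a by rw [key x, key y]
  intro z
  obtain ⟨k, hk⟩ := h.exists_pow_pos a z
  have hpow : (P ^ k).mulVec g = g := by
    clear hk
    induction k with
    | zero => simp
    | succ k ih => rw [pow_succ, ← Matrix.mulVec_mulVec, hg, ih]
  have hmem := pow_mem h.stochastic k
  have hsum : ∑ w, (P ^ k) a w * (g a - g w) = 0 := by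
    have h1 : ∑ w, (P ^ k) a w * g w = g a := congrFun hpow a
    simp only [mul_sub, Finset.sum_sub_distrib, ← Finset.sum_mul,
      Matrix.sum_row_of_mem_rowStochastic hmem, h1]
    ring
  have h0 := (Finset.sum_eq_zero_iff_of_nonneg fun w _ =>
    mul_nonneg (Matrix.nonneg_of_mem_rowStochastic hmem) (sub_nonneg.2 (ha w))).1 hsum z
      (Finset.mem_univ z)
  rcases mul_eq_zero.1 h0 with h1 | h1
  · exact absurd h1 hk.ne'
  · linarith

lemma sum_mul_mulVec (h : IsReversibleChain P p) (g : S → ℝ) :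
    ∑ x, p x * P.mulVec g x = ∑ x, p x * g x := by
  simp only [Matrix.mulVec, dotProduct, Finset.mul_sum]
  rw [Finset.sum_comm]
  refine Finset.sum_congr rfl fun y _ => ?_
  rw [← h.sum_mul_col y, Finset.sum_mul]
  exact Finset.sum_congr rfl fun x _ => by ring

/-- Solvability of the Poisson equation for mean-zero right-hand sides. -/
lemma exists_poisson (h : IsReversibleChain P p) (f : S → ℝ) (hf : ∑ x, p x * f x = 0) :
    ∃ g : S → ℝ, ∀ x, g x - P.mulVec g x = f x := by
  -- The operator I - P is singular on constants; adding the mean under `p` makes it injective,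
  -- hence bijective. As `T` preserves the mean, a mean-zero right-hand side has a mean-zero
  -- preimage, for which the added term vanishes.
  let T : (S → ℝ) →ₗ[ℝ] (S → ℝ) := LinearMap.id - P.mulVecLin +
    { toFun := fun g _ => ∑ x, p x * g x
      map_add' := fun a b => by funext; simp [mul_add, Finset.sum_add_distrib]
      map_smul' := fun c a => by
        funext; simp only [Pi.smul_apply, smul_eq_mul, Finset.mul_sum, RingHom.id_apply]
        exact Finset.sum_congr rfl fun x _ => by ring }
  have hT : ∀ g x, T g x = g x - P.mulVec g x + ∑ y, p y * g y := fun g x => rfl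
  have hTmean : ∀ g, ∑ x, p x * T g x = ∑ y, p y * g y := by
    intro g
    simp only [hT, mul_add, mul_sub, Finset.sum_add_distrib, Finset.sum_sub_distrib,
      h.sum_mul_mulVec, ← Finset.sum_mul, h.sum_stationary]
    ring
  have hinj : Function.Injective T := by
    refine (injective_iff_map_eq_zero T).2 fun g hg => ?_
    have hm : ∑ y, p y * g y = 0 := by rw [← hTmean, hg]; simp
    have hharm : P.mulVec g = g := by
      funext x
      have := congrFun hg x
      rw [hT, hm] at this
      simp only [Pi.zero_apply] at this
      linarith
    funext x
    have hc : ∀ y, g y = g x := fun y => h.harmonic_const hharm y x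
    simp only [hc, ← Finset.sum_mul, h.sum_stationary, one_mul] at hm
    exact hm
  obtain ⟨g, hg⟩ := LinearMap.injective_iff_surjective.1 hinj f
  refine ⟨g, fun x => ?_⟩
  have hm : ∑ y, p y * g y = 0 := by rw [← hTmean, hg, hf]
  have := congrFun hg x
  rw [hT, hm] at this
  linarith

lemma abs_eigenvalue_le_one (h : IsReversibleChain P p) {l : ℝ}
    (hl : Module.End.HasEigenvalue (Matrix.toLin' P) l) : |l| ≤ 1 := by
  have := h.nonempty
  obtain ⟨v, hv⟩ := hl.exists_hasEigenvector
  have hv0 : v ≠ 0 := hv.2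
  have hv1 : ∀ x, P.mulVec v x = l * v x := fun x => by
    have := congrFun hv.apply_eq_smul x
    simpa using this
  obtain ⟨a, ha⟩ := Finite.exists_max fun x => |v x|
  have hpos : 0 < |v a| := by
    by_contra! hle
    exact hv0 (funext fun x => abs_nonpos_iff.1 ((ha x).trans hle))
  have : |l| * |v a| ≤ 1 * |v a| := by
    rw [← abs_mul, ← hv1, ← h.sum_row a, Finset.sum_mul]
    refine (Finset.abs_sum_le_sum_abs _ _).trans (Finset.sum_le_sum fun y _ => ?_)
    rw [abs_mul, abs_of_nonneg (h.nonneg a y)]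
    exact mul_le_mul_of_nonneg_left (ha y) (h.nonneg a y)
  exact le_of_mul_le_mul_right this hpos

end IsReversibleChain

/-! ### Second eigenvalue, spectral gap and Poincaré inequality. -/

lemma finite_eigenvalues_ne_one (P : Matrix S S ℝ) :
    {l : ℝ | l ≠ 1 ∧ Module.End.HasEigenvalue (Matrix.toLin' P) l}.Finite :=
  (Module.End.finite_hasEigenvalue (Matrix.toLin' P)).subset fun _ hl => hl.2

lemma le_secondEigenvalue {P : Matrix S S ℝ} {l : ℝ} (h1 : l ≠ 1)
    (hl : Module.End.HasEigenvalue (Matrix.toLin' P) l) : l ≤ secondEigenvalue P :=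
  le_csSup (finite_eigenvalues_ne_one P).bddAbove ⟨h1, hl⟩

namespace IsReversibleChain

variable {P : Matrix S S ℝ} {p : S → ℝ}

/-- The supremum of a nonempty finite set is attained; the value 0 is the default of `sSup` on the
empty set. -/
lemma secondEigenvalue_mem_or (P : Matrix S S ℝ) : secondEigenvalue P = 0 ∨
    (secondEigenvalue P ≠ 1 ∧
      Module.End.HasEigenvalue (Matrix.toLin' P) (secondEigenvalue P)) := by
  rcases Set.eq_empty_or_nonempty
    {l : ℝ | l ≠ 1 ∧ Module.End.HasEigenvalue (Matrix.toLin' P) l} with he | hne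
  · left; rw [secondEigenvalue, he, Real.sSup_empty]
  · right; exact hne.csSup_mem (finite_eigenvalues_ne_one P)

lemma spectralGap_pos (h : IsReversibleChain P p) : 0 < spectralGap P := by
  rw [spectralGap, sub_pos]
  rcases secondEigenvalue_mem_or P with h0 | ⟨h1, h2⟩
  · rw [h0]; exact one_pos
  · exact lt_of_le_of_ne ((le_abs_self _).trans (h.abs_eigenvalue_le_one h2)) h1

lemma spectralGap_le_two (h : IsReversibleChain P p) : spectralGap P ≤ 2 := by
  rw [spectralGap]
  rcases secondEigenvalue_mem_or P with h0 | ⟨h1, h2⟩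
  · rw [h0]; norm_num
  · linarith [(abs_le.1 (h.abs_eigenvalue_le_one h2)).1]

/-- Variational characterisation of the gap (Poincaré inequality). -/
lemma sum_mul_mulVec_le (h : IsReversibleChain P p) (y : S → ℝ) :
    ∑ x, p x * y x * P.mulVec y x ≤
      ∑ x, p x * y x ^ 2 - spectralGap P * (∑ x, p x * y x ^ 2 - (∑ x, p x * y x) ^ 2) := by
  set l := secondEigenvalue P with hl
  let s : S → ℝ := fun x => √(p x)
  have hs : ∀ x, 0 < s x := fun x => Real.sqrt_pos.2 (h.stationary_pos x)
  have hss : ∀ x, s x * s x = p x := fun x => Real.mul_self_sqrt (h.stationary_pos x).le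
  -- With A = D^{1/2} P D^{-1/2}, symmetric by reversibility, and s the unit vector √p, this is B =
  -- l (I - s sᵀ) - (A - s sᵀ). The claim is the quadratic form of B ≥ 0 at the vector s y.
  let B : Matrix S S ℝ := fun x y =>
    l * ((if x = y then 1 else 0) - s x * s y) - (p x * P x y / (s x * s y) - s x * s y)
  have hAs : ∀ x y, p x * P x y / (s x * s y) = s x * P x y / s y := fun x y => by
    have := (hs x).ne'; have := (hs y).ne'
    rw [← hss x]; field_simp
  have hBv : ∀ v x, B.mulVec v x =
      l * v x - l * s x * (∑ y, s y * v y) - s x * P.mulVec (fun y => v y / s y) x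
        + s x * ∑ y, s y * v y := by
    intro v x
    have : ∀ y, B x y * v y = l * ((if x = y then 1 else 0) * v y) - l * s x * (s y * v y)
        - s x * (P x y * (v y / s y)) + s x * (s y * v y) := by
      intro y
      simp only [B, hAs]
      ring
    simp only [Matrix.mulVec, dotProduct, this, Finset.sum_add_distrib, Finset.sum_sub_distrib,
      ← Finset.mul_sum]
    simp
  have hsP : ∀ g : S → ℝ, ∑ x, s x * (s x * P.mulVec g x) = ∑ x, p x * g x := by
    intro g
    rw [← h.sum_mul_mulVec]
    exact Finset.sum_congr rfl fun x _ => by rw [← mul_assoc, hss]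
  have hherm : B.IsHermitian := by
    refine Matrix.IsHermitian.ext fun i j => ?_
    have := h.reversible i j
    simp only [B, star_trivial, this, mul_comm (s j), eq_comm (a := j)]
  have hpsd : B.PosSemidef := by
    rw [hherm.posSemidef_iff_eigenvalues_nonneg]
    intro i
    -- An eigenvector of B for e < 0 is orthogonal to s, so dividing it by s gives an eigenfunction
    -- of P for l - e > l. By maximality of l this eigenvalue is 1; then the eigenfunction is
    -- constant with mean zero, hence zero.
    by_contra hneg
    simp only [Pi.zero_apply, not_le] at hneg
    set e := hherm.eigenvalues i
    let v : S → ℝ := hherm.eigenvectorBasis i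
    have hv0 : v ≠ 0 := (WithLp.ofLp_eq_zero 2).ne.2 <|
      hherm.eigenvectorBasis.orthonormal.ne_zero i
    have hv : ∀ x, B.mulVec v x = e * v x := fun x =>
      congrFun (hherm.mulVec_eigenvectorBasis i) x
    let g : S → ℝ := fun y => v y / s y
    have hvg : ∀ y, v y = s y * g y := fun y => by
      have := (hs y).ne'; simp only [g]; field_simp
    have hpg : ∑ x, p x * g x = ∑ x, s x * v x :=
      Finset.sum_congr rfl fun x _ => by rw [hvg, ← mul_assoc, hss]
    have hS : ∑ x, s x * v x = 0 := by
      have h1 : ∑ x, s x * B.mulVec v x = 0 := by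
        have : ∀ x, s x * B.mulVec v x = l * (s x * v x)
            - p x * (l * ∑ y, s y * v y) - s x * (s x * P.mulVec g x)
            + p x * ∑ y, s y * v y := by
          intro x
          rw [hBv, ← hss x]; ring
        simp only [this, Finset.sum_add_distrib, Finset.sum_sub_distrib, hsP, hpg,
          ← Finset.mul_sum, ← Finset.sum_mul, h.sum_stationary]
        ring
      have h2 : ∑ x, s x * B.mulVec v x = e * ∑ x, s x * v x := by
        rw [Finset.mul_sum]
        exact Finset.sum_congr rfl fun x _ => by rw [hv]; ring
      rw [h1] at h2
      exact (mul_eq_zero.1 h2.symm).resolve_left hneg.ne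
    have hPg : P.mulVec g = (l - e) • g := by
      funext x
      have h1 := hv x
      rw [hBv, hS, hvg x] at h1
      have h2 : s x * P.mulVec g x = s x * ((l - e) * g x) := by linarith
      exact mul_left_cancel₀ (hs x).ne' h2
    have hg0 : g ≠ 0 := by
      intro hg
      apply hv0
      funext x
      rw [hvg, hg]; simp
    have heig : Module.End.HasEigenvalue (Matrix.toLin' P) (l - e) :=
      Module.End.hasEigenvalue_of_hasEigenvector (x := g)
        ⟨Module.End.mem_eigenspace_iff.2 (by simpa using hPg), hg0⟩
    by_cases h1 : l - e = 1
    · rw [h1, one_smul] at hPg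
      apply hg0
      funext x
      have hc : ∀ y, g y = g x := fun y => h.harmonic_const hPg y x
      rw [hS] at hpg
      simp only [hc, ← Finset.sum_mul, h.sum_stationary, one_mul] at hpg
      simpa using hpg
    · linarith [le_secondEigenvalue h1 heig]
  have hq := hpsd.dotProduct_mulVec_nonneg (fun x => s x * y x)
  simp only [dotProduct, Pi.star_apply, star_trivial, hBv] at hq
  have e1 : (fun z => s z * y z / s z) = y := by
    funext z; have := (hs z).ne'; field_simp
  have e2 : ∑ z, s z * (s z * y z) = ∑ z, p z * y z :=
    Finset.sum_congr rfl fun z _ => by rw [← mul_assoc, hss]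
  rw [e1, e2] at hq
  have e3 : ∀ x, s x * y x * (l * (s x * y x) - l * s x * (∑ z, p z * y z)
      - s x * P.mulVec y x + s x * ∑ z, p z * y z) =
      l * (p x * y x ^ 2) - (p x * y x) * (l * ∑ z, p z * y z) - p x * y x * P.mulVec y x
        + (p x * y x) * ∑ z, p z * y z := by
    intro x; rw [← hss x]; ring
  simp only [e3, Finset.sum_add_distrib, Finset.sum_sub_distrib, ← Finset.mul_sum,
    ← Finset.sum_mul] at hq
  rw [spectralGap, ← hl]
  linarith

lemma sum_mul_mulVec_comm (h : IsReversibleChain P p) (u v : S → ℝ) :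
    ∑ x, p x * u x * P.mulVec v x = ∑ x, p x * v x * P.mulVec u x := by
  simp only [Matrix.mulVec, dotProduct, Finset.mul_sum]
  rw [Finset.sum_comm]
  refine Finset.sum_congr rfl fun y _ => Finset.sum_congr rfl fun x _ => ?_
  have := h.reversible x y
  calc p x * u x * (P x y * v y) = (p x * P x y) * (u x * v y) := by ring
    _ = (p y * P y x) * (u x * v y) := by rw [this]
    _ = _ := by ring

end IsReversibleChain
end ChainAnalysis

/-! ### Concentration of additive functionals -/

section Concentration

variable {S : Type*} [Fintype S] [DecidableEq S]

/-- `tiltedMoment P F k x` is the expectation of `exp (F (X 0) + ⋯ + F (X (k - 1)))` for the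
chain started in `x`. -/
noncomputable def tiltedMoment (P : Matrix S S ℝ) (F : S → ℝ) : ℕ → S → ℝ
  | 0 => fun _ => 1
  | k + 1 => fun x => Real.exp (F x) * P.mulVec (tiltedMoment P F k) x

namespace IsReversibleChain

variable {P : Matrix S S ℝ} {p : S → ℝ}

/-- Since e^{-F} ≥ 1 - F, it suffices to bound the mean of F y². Write y as its mean m plus a
fluctuation: the term F m² averages to zero, Young's inequality splits the cross term, and the gap
term of the Poincaré inequality absorbs the fluctuation. Hence the loss is only quadratic in τ. -/
lemma dirichlet_le_tilted (h : IsReversibleChain P p) {F : S → ℝ} {τ : ℝ}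
    (hF : ∀ x, |F x| ≤ τ) (hF0 : ∑ x, p x * F x = 0) (hτ : τ ≤ spectralGap P / 15)
    (y : S → ℝ) :
    ∑ x, p x * y x * P.mulVec y x ≤
      (1 + 15 / 2 * τ ^ 2 / spectralGap P) * ∑ x, p x * (Real.exp (-F x) * y x ^ 2) := by
  have hε := h.spectralGap_pos
  have hε2 := h.spectralGap_le_two
  have hgap := h.sum_mul_mulVec_le y
  set ε := spectralGap P
  set m := ∑ x, p x * y x with hm
  set W := ∑ x, p x * y x ^ 2 with hW
  have hτ0 : 0 ≤ τ := by
    obtain ⟨x⟩ := h.nonempty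
    exact (abs_nonneg _).trans (hF x)
  have hV : ∑ x, p x * (y x - m) ^ 2 = W - m ^ 2 := by
    have : ∀ x, p x * (y x - m) ^ 2 = p x * y x ^ 2 - 2 * m * (p x * y x) + p x * m ^ 2 := by
      intro x; ring
    simp only [this, Finset.sum_add_distrib, Finset.sum_sub_distrib, ← Finset.mul_sum,
      ← Finset.sum_mul, h.sum_stationary, ← hm]
    ring
  have hV0 : 0 ≤ W - m ^ 2 := by
    rw [← hV]
    exact Finset.sum_nonneg fun x _ => mul_nonneg (h.stationary_pos x).le (sq_nonneg _)
  have hpt : ∀ x, F x * y x ^ 2 ≤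
      F x * m ^ 2 + 7 * τ ^ 2 / ε * m ^ 2 + (ε / 7 + ε / 15) * (y x - m) ^ 2 := by
    intro x
    have hF2 : F x ^ 2 ≤ τ ^ 2 := sq_le_sq' (abs_le.1 (hF x)).1 (abs_le.1 (hF x)).2
    have h1 : 2 * (m * F x) * (y x - m) ≤ 7 / ε * (m * F x) ^ 2 + ε / 7 * (y x - m) ^ 2 := by
      have : 0 ≤ ε / 7 * (7 / ε * (m * F x) - (y x - m)) ^ 2 := by positivity
      have e : ε / 7 * (7 / ε * (m * F x) - (y x - m)) ^ 2 =
          7 / ε * (m * F x) ^ 2 - 2 * (m * F x) * (y x - m) + ε / 7 * (y x - m) ^ 2 := by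
        field_simp; ring
      linarith
    have h2 : 7 / ε * (m * F x) ^ 2 ≤ 7 * τ ^ 2 / ε * m ^ 2 := by
      have : 7 / ε * m ^ 2 * F x ^ 2 ≤ 7 / ε * m ^ 2 * τ ^ 2 :=
        mul_le_mul_of_nonneg_left hF2 (by positivity)
      calc _ = 7 / ε * m ^ 2 * F x ^ 2 := by ring
        _ ≤ _ := this
        _ = _ := by ring
    have h3 : F x * (y x - m) ^ 2 ≤ ε / 15 * (y x - m) ^ 2 :=
      mul_le_mul_of_nonneg_right ((abs_le.1 (hF x)).2.trans hτ) (sq_nonneg _)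
    nlinarith
  have hQ : ∑ x, p x * (F x * y x ^ 2) ≤
      7 * τ ^ 2 / ε * m ^ 2 + (ε / 7 + ε / 15) * (W - m ^ 2) := by
    calc ∑ x, p x * (F x * y x ^ 2) ≤ ∑ x, p x *
          (F x * m ^ 2 + 7 * τ ^ 2 / ε * m ^ 2 + (ε / 7 + ε / 15) * (y x - m) ^ 2) :=
        Finset.sum_le_sum fun x _ => mul_le_mul_of_nonneg_left (hpt x) (h.stationary_pos x).le
      _ = (∑ x, p x * F x) * m ^ 2 + (∑ x, p x) * (7 * τ ^ 2 / ε * m ^ 2)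
          + (ε / 7 + ε / 15) * ∑ x, p x * (y x - m) ^ 2 := by
        rw [Finset.sum_mul, Finset.sum_mul, Finset.mul_sum, ← Finset.sum_add_distrib,
          ← Finset.sum_add_distrib]
        exact Finset.sum_congr rfl fun x _ => by ring
      _ = _ := by rw [hF0, h.sum_stationary, hV]; ring
  have hexp : W - ∑ x, p x * (F x * y x ^ 2) ≤ ∑ x, p x * (Real.exp (-F x) * y x ^ 2) := by
    rw [hW, ← Finset.sum_sub_distrib]
    refine Finset.sum_le_sum fun x _ => ?_
    have h1 := Real.add_one_le_exp (-F x)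
    have := mul_le_mul_of_nonneg_left (mul_le_mul_of_nonneg_right h1 (sq_nonneg (y x)))
      (h.stationary_pos x).le
    linarith
  set q := τ ^ 2 / ε with hq
  have hq0 : 0 ≤ q := by positivity
  -- From τ ≤ ε / 15 and ε ≤ 2. This makes 1 + 15 q / 2 ≤ 16 / 15, just enough to pass from the
  -- Young constant 7 to 15 / 2.
  have hq1 : q ≤ 2 / 225 := by
    rw [hq, div_le_iff₀ hε]
    nlinarith
  have e1 : 15 / 2 * τ ^ 2 / ε = 15 / 2 * q := by rw [hq]; ring
  have e2 : 7 * τ ^ 2 / ε = 7 * q := by rw [hq]; ring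
  rw [e1]
  rw [e2] at hQ
  refine le_trans ?_ (mul_le_mul_of_nonneg_left hexp (by positivity))
  have h3 : (1 + 15 / 2 * q) * ∑ x, p x * (F x * y x ^ 2) ≤
      (1 + 15 / 2 * q) * (7 * q * m ^ 2 + (ε / 7 + ε / 15) * (W - m ^ 2)) :=
    mul_le_mul_of_nonneg_left hQ (by positivity)
  have h4 : (1 + 15 / 2 * q) * (7 * q * m ^ 2) ≤ 15 / 2 * q * m ^ 2 := by
    have : (1 + 15 / 2 * q) * 7 ≤ 15 / 2 := by linarith
    have := mul_le_mul_of_nonneg_right this (mul_nonneg hq0 (sq_nonneg m))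
    linarith
  have h5 : (1 + 15 / 2 * q) * ((ε / 7 + ε / 15) * (W - m ^ 2)) ≤ ε * (W - m ^ 2) := by
    have : (1 + 15 / 2 * q) * (22 / 105) ≤ 1 := by linarith
    have := mul_le_mul_of_nonneg_right this (mul_nonneg hε.le hV0)
    linarith
  have h6 : 0 ≤ 15 / 2 * q * (W - m ^ 2) := by positivity
  linarith

/-- As P has nonnegative entries, the form at `y` is dominated by the form at `|y|`. Thus a gap
below 1 alone suffices, with no control of eigenvalues near -1. -/
lemma abs_form_le (h : IsReversibleChain P p) {F : S → ℝ} {τ : ℝ}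
    (hF : ∀ x, |F x| ≤ τ) (hF0 : ∑ x, p x * F x = 0) (hτ : τ ≤ spectralGap P / 15)
    (y : S → ℝ) :
    |∑ x, p x * y x * P.mulVec y x| ≤
      (1 + 15 / 2 * τ ^ 2 / spectralGap P) * ∑ x, p x * (Real.exp (-F x) * y x ^ 2) := by
  have h1 := h.dirichlet_le_tilted hF hF0 hτ (fun x => |y x|)
  simp only [sq_abs] at h1
  refine le_trans ?_ h1
  refine (Finset.abs_sum_le_sum_abs _ _).trans (Finset.sum_le_sum fun x _ => ?_)
  rw [abs_mul, abs_mul, abs_of_pos (h.stationary_pos x)]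
  refine mul_le_mul_of_nonneg_left ?_
    (mul_nonneg (h.stationary_pos x).le (abs_nonneg _))
  refine (Finset.abs_sum_le_sum_abs _ _).trans (Finset.sum_le_sum fun z _ => ?_)
  rw [abs_mul, abs_of_nonneg (h.nonneg x z)]

/-- A self-adjoint operator has its norm bounded by its quadratic form. This is done by
polarisation: with v the image of u, compare the forms at v + ρ u and v - ρ u. -/
lemma tilted_norm_contract (h : IsReversibleChain P p) {F : S → ℝ} {τ : ℝ}
    (hF : ∀ x, |F x| ≤ τ) (hF0 : ∑ x, p x * F x = 0) (hτ : τ ≤ spectralGap P / 15)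
    (u : S → ℝ) :
    ∑ x, p x * (Real.exp (-F x) * (Real.exp (F x) * P.mulVec u x) ^ 2) ≤
      (1 + 15 / 2 * τ ^ 2 / spectralGap P) ^ 2 *
        ∑ x, p x * (Real.exp (-F x) * u x ^ 2) := by
  have hε := h.spectralGap_pos
  set ρ := 1 + 15 / 2 * τ ^ 2 / spectralGap P with hρ
  have hρ0 : 0 < ρ := by positivity
  let v : S → ℝ := fun x => Real.exp (F x) * P.mulVec u x
  set Nv := ∑ x, p x * (Real.exp (-F x) * v x ^ 2) with hNv
  set Nu := ∑ x, p x * (Real.exp (-F x) * u x ^ 2) with hNu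
  have hcross : ∑ x, p x * v x * P.mulVec u x = Nv := by
    refine Finset.sum_congr rfl fun x _ => ?_
    have : Real.exp (-F x) * Real.exp (F x) = 1 := by rw [← Real.exp_add]; simp
    simp only [v]
    calc _ = p x * (1 * (Real.exp (F x) * (P.mulVec u x) ^ 2)) := by ring
      _ = _ := by rw [← this]; ring
  have hcross' : ∑ x, p x * u x * P.mulVec v x = Nv := by
    rw [← hcross]; exact h.sum_mul_mulVec_comm u v
  have key : ∀ c : ℝ, ∑ x, p x * (v x + c * u x) * P.mulVec (fun x => v x + c * u x) x =
      ∑ x, p x * v x * P.mulVec v x + 2 * c * Nv + c ^ 2 * ∑ x, p x * u x * P.mulVec u x := by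
    intro c
    have e : ∀ x, P.mulVec (fun x => v x + c * u x) x = P.mulVec v x + c * P.mulVec u x := by
      intro x
      simp only [Matrix.mulVec, dotProduct, mul_add, Finset.sum_add_distrib, Finset.mul_sum]
      congr 1
      exact Finset.sum_congr rfl fun z _ => by ring
    have e' : ∀ x, p x * (v x + c * u x) * (P.mulVec v x + c * P.mulVec u x) =
        p x * v x * P.mulVec v x + c * (p x * v x * P.mulVec u x)
          + c * (p x * u x * P.mulVec v x) + c ^ 2 * (p x * u x * P.mulVec u x) := by
      intro x; ring
    simp only [e, e', Finset.sum_add_distrib, ← Finset.mul_sum, hcross, hcross']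
    ring
  have key' : ∀ c : ℝ, ∑ x, p x * (Real.exp (-F x) * (v x + c * u x) ^ 2) =
      Nv + 2 * c * ∑ x, p x * (Real.exp (-F x) * (v x * u x)) + c ^ 2 * Nu := by
    intro c
    rw [hNv, hNu, Finset.mul_sum, Finset.mul_sum, ← Finset.sum_add_distrib,
      ← Finset.sum_add_distrib]
    exact Finset.sum_congr rfl fun x _ => by ring
  have b1 := (abs_le.1 (h.abs_form_le hF hF0 hτ (fun x => v x + ρ * u x))).2
  have b2 := (abs_le.1 (h.abs_form_le hF hF0 hτ (fun x => v x + (-ρ) * u x))).1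
  rw [key, key'] at b1 b2
  have h4 : ρ * (4 * Nv) ≤ ρ * (2 * Nv + 2 * ρ ^ 2 * Nu) := by
    linarith
  have := le_of_mul_le_mul_left h4 hρ0
  change Nv ≤ ρ ^ 2 * Nu
  linarith

/-- Iterating the contraction bounds the weighted ℓ² norm; a single term of that norm bounds the
value at x, at the cost of 1 / √(p x). -/
lemma tiltedMoment_le (h : IsReversibleChain P p) {F : S → ℝ} {τ : ℝ}
    (hF : ∀ x, |F x| ≤ τ) (hF0 : ∑ x, p x * F x = 0) (hτ : τ ≤ spectralGap P / 15)
    (k : ℕ) (x : S) :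
    tiltedMoment P F k x ≤
      Real.exp τ * (1 + 15 / 2 * τ ^ 2 / spectralGap P) ^ k / √(p x) := by
  have hε := h.spectralGap_pos
  set ρ := 1 + 15 / 2 * τ ^ 2 / spectralGap P with hρ
  have hρ0 : 0 < ρ := by positivity
  have hN : ∑ z, p z * (Real.exp (-F z) * tiltedMoment P F k z ^ 2) ≤
      (ρ ^ k) ^ 2 * Real.exp τ := by
    induction k with
    | zero =>
      simp only [tiltedMoment, pow_zero, one_pow, mul_one, one_mul]
      calc ∑ z, p z * Real.exp (-F z) ≤ ∑ z, p z * Real.exp τ := by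
            refine Finset.sum_le_sum fun z _ => mul_le_mul_of_nonneg_left ?_
              (h.stationary_pos z).le
            exact Real.exp_le_exp.2 (by linarith [(abs_le.1 (hF z)).1])
        _ = Real.exp τ := by rw [← Finset.sum_mul, h.sum_stationary, one_mul]
    | succ k ih =>
      refine (h.tilted_norm_contract hF hF0 hτ (tiltedMoment P F k)).trans ?_
      calc _ ≤ ρ ^ 2 * ((ρ ^ k) ^ 2 * Real.exp τ) :=
            mul_le_mul_of_nonneg_left ih (by positivity)
        _ = _ := by ring
  have hx : p x * (Real.exp (-F x) * tiltedMoment P F k x ^ 2) ≤ (ρ ^ k) ^ 2 * Real.exp τ :=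
    (Finset.single_le_sum (f := fun z => p z * (Real.exp (-F z) * tiltedMoment P F k z ^ 2))
      (fun z _ => mul_nonneg (h.stationary_pos z).le (by positivity))
      (Finset.mem_univ x)).trans hN
  have hp := h.stationary_pos x
  have hsp : 0 < √(p x) := Real.sqrt_pos.2 hp
  rw [le_div_iff₀ hsp]
  refine le_of_sq_le_sq ?_ (by positivity)
  have h1 : p x * (Real.exp (-τ) * tiltedMoment P F k x ^ 2) ≤ (ρ ^ k) ^ 2 * Real.exp τ := by
    refine le_trans ?_ hx
    have : Real.exp (-τ) ≤ Real.exp (-F x) :=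
      Real.exp_le_exp.2 (by linarith [(abs_le.1 (hF x)).2])
    exact mul_le_mul_of_nonneg_left (mul_le_mul_of_nonneg_right this (sq_nonneg _)) hp.le
  have h2 : Real.exp τ * Real.exp (-τ) = 1 := by rw [← Real.exp_add]; simp
  have h3 := mul_le_mul_of_nonneg_left h1 (Real.exp_pos τ).le
  calc (tiltedMoment P F k x * √(p x)) ^ 2 = p x * tiltedMoment P F k x ^ 2 := by
        rw [mul_pow, Real.sq_sqrt hp.le, mul_comm]
    _ = Real.exp τ * Real.exp (-τ) * (p x * tiltedMoment P F k x ^ 2) := by rw [h2, one_mul]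
    _ = Real.exp τ * (p x * (Real.exp (-τ) * tiltedMoment P F k x ^ 2)) := by ring
    _ ≤ _ := h3
    _ = _ := by ring

end IsReversibleChain

end Concentration

/-! ### Integrals of functions with finitely many values. -/

section FiniteRange

lemma comp_eq_sum_indicator {Ω β : Type*} {W : Ω → β} {s : Finset β} (hW : ∀ ω, W ω ∈ s)
    (G : β → ℝ) :
    (fun ω => G (W ω)) = fun ω => ∑ b ∈ s, {ω | W ω = b}.indicator (fun _ => G b) ω := by
  classical
  funext ω
  rw [Finset.sum_eq_single (W ω)]
  · simp
  · intro b _ hb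
    exact Set.indicator_of_notMem (by simpa using hb.symm) _
  · exact fun hn => absurd (hW ω) hn

variable {Ω : Type*} [MeasurableSpace Ω] (Pr : Measure Ω) [IsProbabilityMeasure Pr]

/-- Only level sets need to be measurable, so no σ-algebra on the values, such as histories, is
required. -/
lemma integrable_of_finite_range {β : Type*} {W : Ω → β} {s : Finset β} (hW : ∀ ω, W ω ∈ s)
    (hm : ∀ b ∈ s, MeasurableSet {ω | W ω = b}) (G : β → ℝ) :
    Integrable (fun ω => G (W ω)) Pr := by
  rw [comp_eq_sum_indicator hW]
  exact integrable_finsetSum _ fun b hb => (integrable_const _).indicator (hm b hb)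

lemma integral_of_finite_range {β : Type*} {W : Ω → β} {s : Finset β} (hW : ∀ ω, W ω ∈ s)
    (hm : ∀ b ∈ s, MeasurableSet {ω | W ω = b}) (G : β → ℝ) :
    ∫ ω, G (W ω) ∂Pr = ∑ b ∈ s, Pr.real {ω | W ω = b} * G b := by
  rw [comp_eq_sum_indicator hW,
    integral_finsetSum _ fun b hb => (integrable_const _).indicator (hm b hb)]
  refine Finset.sum_congr rfl fun b hb => ?_
  rw [integral_indicator_const _ (hm b hb), smul_eq_mul]

end FiniteRange

/-! ### Markov property, exponential moments and the Chernoff bound. -/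

namespace IsMarkovChain

variable {Ω S : Type*} [MeasurableSpace Ω] [Fintype S] [MeasurableSpace S] [MeasurableSingletonClass S]
  {Pr : Measure Ω} {q : S → ℝ} {P : Matrix S S ℝ} {X : ℕ → Ω → S}

lemma measurableSet_eq {S : Type*} [MeasurableSpace S] [MeasurableSingletonClass S]
    {q : S → ℝ} {P : Matrix S S ℝ} {X : ℕ → Ω → S}
    (h : IsMarkovChain Pr q P X) (n : ℕ) (x : S) : MeasurableSet {ω | X n ω = x} :=
  h.measurable n (measurableSet_singleton x)

lemma prob_step {S : Type*} [MeasurableSpace S] {q : S → ℝ} {P : Matrix S S ℝ} {X : ℕ → Ω → S}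
    (h : IsMarkovChain Pr q P X) (x : ℕ → S) (n : ℕ) (z : S) :
    Pr.real {ω | (∀ k ≤ n, X k ω = x k) ∧ X (n + 1) ω = z} =
      Pr.real {ω | ∀ k ≤ n, X k ω = x k} * P (x n) z := by
  have hne : ∀ k ≤ n, Function.update x (n + 1) z k = x k := fun k hk =>
    Function.update_of_ne (by omega) _ _
  have hset : {ω | (∀ k ≤ n, X k ω = x k) ∧ X (n + 1) ω = z} =
      {ω | ∀ k ≤ n + 1, X k ω = Function.update x (n + 1) z k} := by
    ext ω
    constructor
    · rintro ⟨h1, h2⟩ k hk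
      rcases Nat.lt_or_ge n k with hlt | hge
      · obtain rfl : k = n + 1 := by omega
        simpa using h2
      · rw [hne k hge]; exact h1 k hge
    · intro hω
      refine ⟨fun k hk => ?_, ?_⟩
      · rw [← hne k hk]; exact hω k (by omega)
      · simpa using hω (n + 1) le_rfl
  rw [hset, h.path_prob, h.path_prob, Finset.prod_range_succ, hne 0 (by omega), hne n le_rfl,
    Function.update_self, mul_assoc]
  congr 2
  exact Finset.prod_congr rfl fun k hk => by
    rw [Finset.mem_range] at hk
    rw [hne k (by omega), hne (k + 1) (by omega)]

lemma integral_step [IsProbabilityMeasure Pr] (h : IsMarkovChain Pr q P X) (n : ℕ)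
    (Φ : (Fin (n + 1) → S) → ℝ) (g : S → ℝ) :
    ∫ ω, Φ (fun k => X k ω) * g (X (n + 1) ω) ∂Pr =
      ∫ ω, Φ (fun k => X k ω) * P.mulVec g (X n ω) ∂Pr := by
  have hext : ∀ b : Fin (n + 1) → S, ∃ x : ℕ → S, ∀ k : Fin (n + 1), x k = b k := fun b =>
    ⟨fun k => b (Fin.ofNat (n + 1) k), fun k => by simp⟩
  have hset : ∀ (b : Fin (n + 1) → S) (x : ℕ → S), (∀ k : Fin (n + 1), x k = b k) →
      {ω | (fun k : Fin (n + 1) => X k ω) = b} = {ω | ∀ k ≤ n, X k ω = x k} := by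
    intro b x hx
    ext ω
    simp only [Set.mem_ofPred_eq, funext_iff, Fin.forall_iff, Nat.lt_succ_iff]
    refine forall₂_congr fun k hk => ?_
    rw [← hx ⟨k, Nat.lt_succ_iff.2 hk⟩]
  have hm1 : ∀ b : Fin (n + 1) → S, MeasurableSet {ω | (fun k : Fin (n + 1) => X k ω) = b} := by
    intro b
    simp only [funext_iff, Set.ofPred_forall]
    exact MeasurableSet.iInter fun k => h.measurableSet_eq k (b k)
  have hW : ∀ ω, ((fun k : Fin (n + 1) => X k ω), X (n + 1) ω) ∈
      (Finset.univ : Finset ((Fin (n + 1) → S) × S)) := fun ω => Finset.mem_univ _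
  have hm2 : ∀ b ∈ (Finset.univ : Finset ((Fin (n + 1) → S) × S)),
      MeasurableSet {ω | ((fun k : Fin (n + 1) => X k ω), X (n + 1) ω) = b} := by
    rintro ⟨b, z⟩ -
    simp only [Prod.mk.injEq]
    exact (hm1 b).inter (h.measurableSet_eq (n + 1) z)
  refine (integral_of_finite_range Pr hW hm2 fun b => Φ b.1 * g b.2).trans
    (Eq.trans ?_ (integral_of_finite_range Pr (W := fun ω (k : Fin (n + 1)) => X k ω)
      (fun ω => Finset.mem_univ _) (fun b _ => hm1 b)
      fun b => Φ b * P.mulVec g (b (Fin.last n))).symm)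
  rw [Fintype.sum_prod_type]
  refine Finset.sum_congr rfl fun b _ => ?_
  obtain ⟨x, hx⟩ := hext b
  have hstep : ∀ z, Pr.real {ω | ((fun k : Fin (n + 1) => X k ω), X (n + 1) ω) = (b, z)} =
      Pr.real {ω | (fun k : Fin (n + 1) => X k ω) = b} * P (b (Fin.last n)) z := by
    intro z
    have hl : b (Fin.last n) = x n := (hx (Fin.last n)).symm
    rw [hset b x hx, hl, ← h.prob_step x n z]
    congr 1
    ext ω
    have := Set.ext_iff.1 (hset b x hx) ω
    simp only [Set.mem_ofPred_eq] at this
    simp only [Set.mem_ofPred_eq, Prod.mk.injEq, this]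
  simp only [hstep, Matrix.mulVec, dotProduct, Finset.mul_sum]
  exact Finset.sum_congr rfl fun z _ => by ring

/-- Conditioning on the last state turns e^F P applied to `tiltedMoment P F k` into `tiltedMoment P
F (k + 1)`, so the factors are peeled off from the end of the path. -/
lemma integral_exp_sum_mul [IsProbabilityMeasure Pr] (h : IsMarkovChain Pr q P X) (F : S → ℝ)
    (j k : ℕ) :
    ∫ ω, Real.exp (∑ i ∈ Finset.range j, F (X i ω)) * tiltedMoment P F k (X j ω) ∂Pr =
      ∫ ω, tiltedMoment P F (j + k) (X 0 ω) ∂Pr := by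
  induction j generalizing k with
  | zero => simp
  | succ j ih =>
    have e := h.integral_step j (fun b => Real.exp (∑ i, F (b i))) (tiltedMoment P F k)
    have hr : ∀ ω, ∑ i : Fin (j + 1), F (X i ω) = ∑ i ∈ Finset.range (j + 1), F (X i ω) :=
      fun ω => Fin.sum_univ_eq_sum_range (fun i => F (X i ω)) (j + 1)
    simp only [hr] at e
    rw [e, add_right_comm, add_assoc, ← ih (k + 1)]
    refine integral_congr_ae (Filter.Eventually.of_forall fun ω => ?_)
    simp only [Finset.sum_range_succ, Real.exp_add, tiltedMoment]
    ring

lemma integral_exp_sum [IsProbabilityMeasure Pr] (h : IsMarkovChain Pr q P X) (F : S → ℝ)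
    (s : ℕ) :
    ∫ ω, Real.exp (∑ i ∈ Finset.range s, F (X i ω)) ∂Pr =
      ∫ ω, tiltedMoment P F s (X 0 ω) ∂Pr := by
  simpa [tiltedMoment] using h.integral_exp_sum_mul F s 0

lemma integrable_comp [IsProbabilityMeasure Pr] (h : IsMarkovChain Pr q P X) (n : ℕ)
    (g : S → ℝ) : Integrable (fun ω => g (X n ω)) Pr :=
  integrable_of_finite_range Pr (s := Finset.univ) (fun _ => Finset.mem_univ _)
    (fun b _ => h.measurableSet_eq n b) g

lemma integrable_exp_sum [IsProbabilityMeasure Pr] (h : IsMarkovChain Pr q P X) (F : S → ℝ)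
    (s : ℕ) : Integrable (fun ω => Real.exp (∑ i ∈ Finset.range s, F (X i ω))) Pr := by
  have := integrable_of_finite_range Pr (W := fun ω (k : Fin s) => X k ω) (s := Finset.univ)
    (fun _ => Finset.mem_univ _) (fun b _ => by
      simp only [funext_iff, Set.ofPred_forall]
      exact MeasurableSet.iInter fun k => h.measurableSet_eq k (b k))
    (fun b => Real.exp (∑ i, F (b i)))
  have hr : ∀ ω, ∑ i : Fin s, F (X i ω) = ∑ i ∈ Finset.range s, F (X i ω) :=
    fun ω => Fin.sum_univ_eq_sum_range (fun i => F (X i ω)) s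
  simpa only [hr] using this

/-- Chernoff bound for additive functionals of a reversible chain, for an arbitrary initial
distribution. -/
lemma tail_bound [DecidableEq S] [IsProbabilityMeasure Pr] (h : IsMarkovChain Pr q P X) {p : S → ℝ}
    (hP : IsReversibleChain P p) {f : S → ℝ} {b L : ℝ} (hb : 0 < b) (hf : ∀ x, |f x| ≤ b)
    (hf0 : ∑ x, p x * f x = 0) (hL : 90 * b ^ 2 / spectralGap P ≤ L) {s m : ℕ} (hs : 1 ≤ s)
    (hm : 1 ≤ m) :
    Pr.real {ω | √(s * (L * Real.log m)) ≤ ∑ i ∈ Finset.range s, f (X i ω)} ≤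
      (Real.exp 1 * ∑ x, 1 / √(p x)) / (m : ℝ) ^ 3 := by
  have hε := hP.spectralGap_pos
  have hε2 := hP.spectralGap_le_two
  set ε := spectralGap P with hεdef
  set A := ∑ x, 1 / √(p x) with hA
  have hs0 : (0 : ℝ) < s := by exact_mod_cast hs
  have hm0 : (0 : ℝ) < m := by exact_mod_cast hm
  have hlog : 0 ≤ Real.log m := Real.log_natCast_nonneg m
  have hL0 : 0 ≤ L := le_trans (by positivity) hL
  have hA0 : 0 ≤ A := Finset.sum_nonneg fun x _ => by positivity
  set u := √(s * (L * Real.log m)) with hu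
  have hu0 : 0 ≤ u := Real.sqrt_nonneg _
  have hu2 : u ^ 2 = s * (L * Real.log m) := Real.sq_sqrt (by positivity)
  have hsum : ∀ ω, ∑ i ∈ Finset.range s, f (X i ω) ≤ s * b := fun ω => by
    calc _ ≤ ∑ i ∈ Finset.range s, b :=
          Finset.sum_le_sum fun i _ => (le_abs_self _).trans (hf _)
      _ = _ := by simp
  -- Beyond the largest possible value of the sum the event is empty; otherwise u ≤ s b, which is
  -- what keeps τ below ε / 15.
  by_cases hub : s * b < u
  · have : {ω | u ≤ ∑ i ∈ Finset.range s, f (X i ω)} = ∅ := by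
      ext ω
      simp only [Set.mem_ofPred_eq, Set.mem_empty_iff_false, iff_false, not_le]
      exact (hsum ω).trans_lt hub
    rw [this, measureReal_empty]
    positivity
  push Not at hub
  -- The minimiser of -θ u + s (15/2) θ² b² / ε. The minimum is -u² ε / (30 s b²), and 90 = 30 · 3
  -- yields the power m⁻³.
  set θ := u * ε / (15 * s * b ^ 2) with hθ
  have hθ0 : 0 ≤ θ := by positivity
  set τ := θ * b with hτ
  have hτε : τ ≤ ε / 15 := by
    have e : τ = u / (s * b) * (ε / 15) := by rw [hτ, hθ]; field_simp
    rw [e]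
    exact mul_le_of_le_one_left (by positivity) ((div_le_one (by positivity)).2 hub)
  have hF : ∀ x, |θ * f x| ≤ τ := fun x => by
    rw [abs_mul, abs_of_nonneg hθ0]
    exact mul_le_mul_of_nonneg_left (hf x) hθ0
  have hF0 : ∑ x, p x * (θ * f x) = 0 := by
    have : ∀ x, p x * (θ * f x) = θ * (p x * f x) := fun x => by ring
    simp only [this, ← Finset.mul_sum, hf0, mul_zero]
  set δ := 15 / 2 * τ ^ 2 / ε with hδ
  have hδ0 : 0 ≤ δ := by positivity
  have hmom : ∀ x, tiltedMoment P (fun x => θ * f x) s x ≤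
      Real.exp 1 * A * Real.exp (s * δ) := by
    intro x
    have h1 := hP.tiltedMoment_le hF hF0 hτε s x
    have h2 : (1 + δ) ^ s ≤ Real.exp (s * δ) := by
      rw [Real.exp_nat_mul]
      exact pow_le_pow_left₀ (by positivity) (by linarith [Real.add_one_le_exp δ]) _
    have h3 : Real.exp τ ≤ Real.exp 1 := Real.exp_le_exp.2 (by linarith)
    have h4 : 1 / √(p x) ≤ A :=
      Finset.single_le_sum (f := fun z => 1 / √(p z)) (fun z _ => by positivity)
        (Finset.mem_univ x)
    calc _ ≤ Real.exp τ * (1 + δ) ^ s / √(p x) := h1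
      _ = Real.exp τ * (1 + δ) ^ s * (1 / √(p x)) := by ring
      _ ≤ Real.exp 1 * Real.exp (s * δ) * A := by gcongr
      _ = _ := by ring
  have hmgf : mgf (fun ω => ∑ i ∈ Finset.range s, f (X i ω)) Pr θ ≤
      Real.exp 1 * A * Real.exp (s * δ) := by
    have e : mgf (fun ω => ∑ i ∈ Finset.range s, f (X i ω)) Pr θ =
        ∫ ω, tiltedMoment P (fun x => θ * f x) s (X 0 ω) ∂Pr := by
      rw [← h.integral_exp_sum]
      simp only [mgf, Finset.mul_sum]
    rw [e]
    calc _ ≤ ∫ _, Real.exp 1 * A * Real.exp (s * δ) ∂Pr :=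
          integral_mono (h.integrable_comp 0 _) (integrable_const _) fun ω => hmom _
      _ = _ := by simp
  have hint : Integrable (fun ω => Real.exp (θ * ∑ i ∈ Finset.range s, f (X i ω))) Pr := by
    simp only [Finset.mul_sum]
    exact h.integrable_exp_sum (fun x => θ * f x) s
  have hcher := measure_ge_le_exp_mul_mgf (μ := Pr) u hθ0 hint
  refine hcher.trans ?_
  have hexp : -θ * u + s * δ ≤ -(3 * Real.log m) := by
    have e : -θ * u + s * δ = -(u ^ 2 * ε / (30 * s * b ^ 2)) := by
      rw [hδ, hτ, hθ]; field_simp; ring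
    rw [e, hu2, neg_le_neg_iff]
    have h1 : 90 * b ^ 2 ≤ L * ε := (div_le_iff₀ hε).1 hL
    rw [le_div_iff₀ (by positivity)]
    have := mul_le_mul_of_nonneg_left h1 (mul_nonneg hs0.le hlog)
    linarith
  calc Real.exp (-θ * u) * mgf (fun ω => ∑ i ∈ Finset.range s, f (X i ω)) Pr θ
      ≤ Real.exp (-θ * u) * (Real.exp 1 * A * Real.exp (s * δ)) :=
        mul_le_mul_of_nonneg_left hmgf (Real.exp_pos _).le
    _ = Real.exp 1 * A * Real.exp (-θ * u + s * δ) := by rw [Real.exp_add]; ring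
    _ ≤ Real.exp 1 * A * Real.exp (-(3 * Real.log m)) :=
        mul_le_mul_of_nonneg_left (Real.exp_le_exp.2 hexp) (by positivity)
    _ = _ := by
      have : Real.exp (-(3 * Real.log m)) = ((m : ℝ) ^ 3)⁻¹ := by
        rw [Real.exp_neg, show (3 : ℝ) * Real.log m = ((3 : ℕ) : ℝ) * Real.log m by norm_num,
          Real.exp_nat_mul, Real.exp_log hm0]
      rw [this]; rfl

end IsMarkovChain

/-! ### Runs of a policy -/

section Runs

variable {K : ℕ} {S : Fin K → Type*}

lemma plays_append_singleton (h : History S) (e : Σ i : Fin K, S i) (j : Fin K) :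
    plays (h ++ [e]) j = plays h j + if e.1 = j then 1 else 0 := by
  simp [plays, List.countP_append, List.countP_cons]

lemma length_run (α : Policy S) (y : ∀ i, ℕ → S i) (n : ℕ) : (run α y n).length = n := by
  induction n with
  | zero => rfl
  | succ n ih => simp [run, ih]

lemma plays_run_succ (α : Policy S) (y : ∀ i, ℕ → S i) (n : ℕ) (j : Fin K) :
    plays (run α y (n + 1)) j = plays (run α y n) j + if α (run α y n) = j then 1 else 0 := by
  rw [run, plays_append_singleton]

lemma sum_plays (h : History S) : ∑ i, plays h i = h.length := by
  induction h using List.reverseRecOn with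
  | nil => simp [plays]
  | append_singleton h e ih =>
    simp [plays_append_singleton, Finset.sum_add_distrib, ih]

lemma run_succ_eq_iff (α : Policy S) (y y' : ∀ i, ℕ → S i) (n : ℕ) :
    run α y (n + 1) = run α y' (n + 1) ↔ run α y n = run α y' n ∧
      y (α (run α y' n)) (plays (run α y' n) (α (run α y' n))) =
        y' (α (run α y' n)) (plays (run α y' n) (α (run α y' n))) := by
  simp only [run]
  generalize run α y n = h
  generalize run α y' n = h'
  constructor
  · intro e
    obtain ⟨rfl, h2⟩ := List.append_inj' e rfl
    simpa using h2
  · rintro ⟨rfl, h2⟩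
    rw [h2]

/-- Two reward paths give the same history iff they agree on the states that were shown. -/
lemma run_eq_iff (α : Policy S) (y y' : ∀ i, ℕ → S i) (n : ℕ) :
    run α y n = run α y' n ↔ ∀ j, ∀ k < plays (run α y' n) j, y j k = y' j k := by
  induction n with
  | zero => simp [run, plays]
  | succ n ih =>
    rw [run_succ_eq_iff, ih]
    constructor
    · rintro ⟨h1, h2⟩ j k hk
      rw [plays_run_succ] at hk
      by_cases hkj : k < plays (run α y' n) j
      · exact h1 j k hkj
      · split_ifs at hk with hj
        · subst hj
          obtain rfl : k = plays (run α y' n) (α (run α y' n)) := by omega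
          exact h2
        · omega
    · intro h
      refine ⟨fun j k hk => h j k ?_, h _ _ ?_⟩
      · rw [plays_run_succ]; omega
      · rw [plays_run_succ, if_pos rfl]; omega

lemma sampleMean_run (r : ∀ i, S i → ℝ) (α : Policy S) (y : ∀ i, ℕ → S i) (n : ℕ) (i : Fin K) :
    sampleMean r (run α y n) i =
      (∑ k ∈ Finset.range (plays (run α y n) i), r i (y i k)) / plays (run α y n) i := by
  unfold sampleMean
  congr 1
  induction n with
  | zero => simp [run, plays]
  | succ n ih =>
    rw [plays_run_succ, run, List.map_append, List.sum_append, ih]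
    by_cases h : α (run α y n) = i
    · subst h
      simp [Finset.sum_range_succ]
    · simp [h]

/-- The arm played after time `n`, with the state it shows and the state it moves to. -/
def nextStates (α : Policy S) (y : ∀ i, ℕ → S i) (n : ℕ) : Σ i : Fin K, S i × S i :=
  ⟨α (run α y n), y _ (plays (run α y n) (α (run α y n))),
    y _ (plays (run α y n) (α (run α y n)) + 1)⟩

lemma run_nextStates_eq_iff (α : Policy S) (y y' : ∀ i, ℕ → S i) (n : ℕ)
    (z : S (α (run α y' n))) :
    (run α y n, nextStates α y n) = (run α y' n, ⟨α (run α y' n),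
      y' _ (plays (run α y' n) (α (run α y' n))), z⟩) ↔
    run α y (n + 1) = run α y' (n + 1) ∧
      y (α (run α y' n)) (plays (run α y' n) (α (run α y' n)) + 1) = z := by
  constructor
  · intro h
    rw [Prod.mk.injEq] at h
    obtain ⟨h1, h2⟩ := h
    rw [nextStates, h1] at h2
    simp only [Sigma.mk.injEq, heq_eq_eq, true_and, Prod.mk.injEq] at h2
    exact ⟨(run_succ_eq_iff α y y' n).2 ⟨h1, h2.1⟩, h2.2⟩
  · rintro ⟨h1, h2⟩
    have h0 := (run_eq_iff α y y' (n + 1)).1 h1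
    have h3 : run α y n = run α y' n := by
      rw [run_eq_iff]
      intro j k hk
      refine h0 j k ?_
      rw [plays_run_succ]; omega
    have h4 := h0 (α (run α y' n)) (plays (run α y' n) (α (run α y' n)))
      (by rw [plays_run_succ, if_pos rfl]; omega)
    rw [Prod.mk.injEq, nextStates, h3, h4, h2]
    exact ⟨rfl, rfl⟩

/-- Observing a given history is a rectangle event, one condition on an initial segment of each arm;
this is how independence of the arms is used for an adaptive policy. -/
lemma setOf_run_eq (α : Policy S) (y : ∀ i, ℕ → S i) (n : ℕ) {Ω : Type*}
    (X : ∀ i, ℕ → Ω → S i) :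
    {ω | run α (fun i m => X i m ω) n = run α y n} =
      ⋂ j, (fun ω m => X j m ω) ⁻¹' {w | ∀ k < plays (run α y n) j, w k = y j k} := by
  ext ω
  simp [run_eq_iff]

lemma run_mem_lists [∀ i, Fintype (S i)] (α : Policy S) (y : ∀ i, ℕ → S i) (n : ℕ) :
    run α y n ∈ (List.finite_length_eq (Σ i : Fin K, S i) n).toFinset := by
  simp [length_run]

end Runs

/-! ### The law of a run -/

section Law

variable {K : ℕ} {S : Fin K → Type*} [∀ i, MeasurableSpace (S i)]
  {Ω : Type*} [MeasurableSpace Ω] {Pr : Measure Ω}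
  {q : ∀ i, S i → ℝ} {P : ∀ i, Matrix (S i) (S i) ℝ} {X : ∀ i, ℕ → Ω → S i}

lemma measurableSet_agree {S : Type*} [MeasurableSpace S] [MeasurableSingletonClass S] (N : ℕ)
    (y : ℕ → S) : MeasurableSet {w : ℕ → S | ∀ k < N, w k = y k} := by
  simp only [Set.ofPred_forall]
  exact MeasurableSet.iInter fun k => MeasurableSet.iInter fun _ =>
    (measurable_pi_apply k : Measurable fun w : ℕ → S => w k) (measurableSet_singleton (y k))

variable [∀ i, MeasurableSingletonClass (S i)]

lemma measurableSet_run_eq (hX : ∀ i, IsMarkovChain Pr (q i) (P i) (X i)) (α : Policy S) (n : ℕ)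
    (h : History S) : MeasurableSet {ω | run α (fun i m => X i m ω) n = h} := by
  by_cases hex : ∃ y, run α y n = h
  · obtain ⟨y, rfl⟩ := hex
    rw [setOf_run_eq]
    exact MeasurableSet.iInter fun j =>
      measurable_pi_iff.2 (fun m => (hX j).measurable m) (measurableSet_agree _ _)
  · have : {ω | run α (fun i m => X i m ω) n = h} = ∅ := by
      ext ω
      simp only [Set.mem_ofPred_eq, Set.mem_empty_iff_false, iff_false]
      exact fun hω => hex ⟨_, hω⟩
    rw [this]
    exact MeasurableSet.empty

/-- After a play, the arm that was played moves according to its transition matrix,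
independently of everything else observed so far. -/
lemma prob_run_step (hX : ∀ i, IsMarkovChain Pr (q i) (P i) (X i))
    (hind : iIndepFun (fun i ω => (fun m => X i m ω : ℕ → S i)) Pr) (α : Policy S)
    (y : ∀ i, ℕ → S i) (n : ℕ) {i : Fin K} {T : ℕ} (hi : α (run α y n) = i)
    (hT : plays (run α y n) i = T) (z : S i) :
    Pr.real {ω | run α (fun i m => X i m ω) (n + 1) = run α y (n + 1) ∧ X i (T + 1) ω = z} =
      Pr.real {ω | run α (fun i m => X i m ω) (n + 1) = run α y (n + 1)} * P i (y i T) z := by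
  have hprod : ∀ B : ∀ j, Set (ℕ → S j), (∀ j, MeasurableSet (B j)) →
      Pr.real (⋂ j, (fun ω m => X j m ω) ⁻¹' B j) =
        ∏ j, Pr.real ((fun ω m => X j m ω) ⁻¹' B j) := by
    intro B hB
    have := hind.measure_inter_preimage_eq_mul Finset.univ (sets := B) fun j _ => hB j
    simp only [Finset.mem_univ, Set.iInter_true] at this
    simp only [Measure.real, this, ENNReal.toReal_prod]
  let A : ∀ j, Set (ℕ → S j) := fun j => {w | ∀ k < plays (run α y (n + 1)) j, w k = y j k}
  have hA : ∀ j, MeasurableSet (A j) := fun j => measurableSet_agree _ _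
  -- The extra condition on the next state changes only the factor of arm `i`, whose segment ends
  -- exactly at index `T`.
  let B : ∀ j, Set (ℕ → S j) := Function.update A i (A i ∩ {w | w (T + 1) = z})
  have hBi : B i = A i ∩ {w | w (T + 1) = z} := Function.update_self _ _ _
  have hBj : ∀ j, j ≠ i → B j = A j := fun j hj => Function.update_of_ne hj _ _
  have hB : ∀ j, MeasurableSet (B j) := by
    intro j
    by_cases hj : j = i
    · subst hj
      rw [hBi]
      exact (hA _).inter ((measurable_pi_apply (T + 1) : Measurable fun w : ℕ → S j => w (T + 1))
        (measurableSet_singleton z))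
    · rw [hBj j hj]; exact hA j
  have hset : {ω | run α (fun i m => X i m ω) (n + 1) = run α y (n + 1) ∧ X i (T + 1) ω = z} =
      ⋂ j, (fun ω m => X j m ω) ⁻¹' B j := by
    ext ω
    simp only [Set.mem_ofPred_eq, run_eq_iff, Set.mem_iInter, Set.mem_preimage]
    constructor
    · rintro ⟨h1, h2⟩ j
      by_cases hj : j = i
      · subst hj
        rw [hBi]; exact ⟨h1 _, h2⟩
      · rw [hBj j hj]; exact h1 j
    · intro h
      have hBA : ∀ j, B j ⊆ A j := by
        intro j
        by_cases hj : j = i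
        · subst hj
          rw [hBi]; exact Set.inter_subset_left
        · rw [hBj j hj]
      refine ⟨fun j => hBA j (h j), ?_⟩
      have := h i
      rw [hBi] at this
      exact this.2
  have hTi : plays (run α y (n + 1)) i = T + 1 := by
    rw [plays_run_succ, if_pos hi, hT]
  have hstep : Pr.real ((fun ω m => X i m ω) ⁻¹' B i) =
      Pr.real ((fun ω m => X i m ω) ⁻¹' A i) * P i (y i T) z := by
    have := (hX i).prob_step (y i) T z
    simp only [← Nat.lt_succ_iff] at this
    rw [hBi]
    simp only [A, hTi]
    exact this
  rw [hset, setOf_run_eq, hprod B hB, hprod A hA,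
    ← Finset.mul_prod_erase _ _ (Finset.mem_univ i),
    ← Finset.mul_prod_erase (s := Finset.univ)
      (fun j => Pr.real ((fun ω m => X j m ω) ⁻¹' A j)) (Finset.mem_univ i), hstep]
  have : ∏ j ∈ Finset.univ.erase i, Pr.real ((fun ω m => X j m ω) ⁻¹' B j) =
      ∏ j ∈ Finset.univ.erase i, Pr.real ((fun ω m => X j m ω) ⁻¹' A j) :=
    Finset.prod_congr rfl fun j hj => by rw [hBj j (Finset.ne_of_mem_erase hj)]
  rw [this]
  ring

/-- What matters is that `c` does not depend on `z`: given the history and the shown state, the next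
state has law `P i x`. A history or state that cannot occur gets `c = 0`. -/
lemma exists_law_run_nextStates (hX : ∀ i, IsMarkovChain Pr (q i) (P i) (X i))
    (hind : iIndepFun (fun i ω => (fun m => X i m ω : ℕ → S i)) Pr) (α : Policy S)
    (n : ℕ) (h : History S) (i : Fin K) (x : S i) :
    ∃ c : ℝ, ∀ z, MeasurableSet {ω | (run α (fun i m => X i m ω) n,
          nextStates α (fun i m => X i m ω) n) = (h, ⟨i, x, z⟩)} ∧
      Pr.real {ω | (run α (fun i m => X i m ω) n,
          nextStates α (fun i m => X i m ω) n) = (h, ⟨i, x, z⟩)} = c * P i x z := by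
  by_cases hex : ∃ ω z, (run α (fun i m => X i m ω) n,
      nextStates α (fun i m => X i m ω) n) = (h, ⟨i, x, z⟩)
  · obtain ⟨ω₀, z₀, h₀⟩ := hex
    set y : ∀ i, ℕ → S i := fun i m => X i m ω₀
    rw [Prod.mk.injEq] at h₀
    obtain ⟨rfl, h₀⟩ := h₀
    rw [nextStates] at h₀
    obtain ⟨rfl, h₁⟩ := Sigma.mk.injEq .. ▸ h₀
    rw [heq_eq_eq, Prod.mk.injEq] at h₁
    obtain ⟨rfl, -⟩ := h₁
    refine ⟨Pr.real {ω | run α (fun i m => X i m ω) (n + 1) = run α y (n + 1)}, fun z => ?_⟩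
    simp only [run_nextStates_eq_iff α _ y n z]
    refine ⟨?_, prob_run_step hX hind α y n rfl rfl z⟩
    exact (measurableSet_run_eq hX α (n + 1) _).inter ((hX _).measurableSet_eq _ z)
  · push Not at hex
    refine ⟨0, fun z => ?_⟩
    have : {ω | (run α (fun i m => X i m ω) n,
          nextStates α (fun i m => X i m ω) n) = (h, ⟨i, x, z⟩)} = ∅ := by
      ext ω
      simp only [Set.mem_ofPred_eq, Set.mem_empty_iff_false, iff_false]
      exact hex ω z
    rw [this, measureReal_empty, zero_mul]
    exact ⟨MeasurableSet.empty, rfl⟩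

variable [∀ i, Fintype (S i)] [IsProbabilityMeasure Pr]

lemma integrable_run (hX : ∀ i, IsMarkovChain Pr (q i) (P i) (X i)) (α : Policy S) (n : ℕ)
    (G : History S → ℝ) : Integrable (fun ω => G (run α (fun i m => X i m ω) n)) Pr :=
  integrable_of_finite_range Pr (fun _ => run_mem_lists α _ n)
    (fun h _ => measurableSet_run_eq hX α n h) G

lemma integral_martingale_increment (hX : ∀ i, IsMarkovChain Pr (q i) (P i) (X i))
    (hind : iIndepFun (fun i ω => (fun m => X i m ω : ℕ → S i)) Pr) (hP : ∀ i x, ∑ z, P i x z = 1)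
    (α : Policy S) (g : ∀ i, S i → ℝ) (n : ℕ) (G : (Σ i : Fin K, S i × S i) → ℝ)
    (hG : ∀ i x z, G ⟨i, x, z⟩ = g i z - (P i).mulVec (g i) x) :
    Integrable (fun ω => G (nextStates α (fun i m => X i m ω) n)) Pr ∧
      ∫ ω, G (nextStates α (fun i m => X i m ω) n) ∂Pr = 0 := by
  classical
  choose c hc using exists_law_run_nextStates hX hind α n
  have hW : ∀ ω, (run α (fun i m => X i m ω) n, nextStates α (fun i m => X i m ω) n) ∈
      (List.finite_length_eq (Σ i : Fin K, S i) n).toFinset ×ˢ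
        (Finset.univ : Finset (Σ i : Fin K, S i × S i)) := fun ω =>
    Finset.mem_product.2 ⟨run_mem_lists α _ n, Finset.mem_univ _⟩
  have hm : ∀ b ∈ (List.finite_length_eq (Σ i : Fin K, S i) n).toFinset ×ˢ
        (Finset.univ : Finset (Σ i : Fin K, S i × S i)),
      MeasurableSet {ω | (run α (fun i m => X i m ω) n,
        nextStates α (fun i m => X i m ω) n) = b} := by
    rintro ⟨h, i, x, z⟩ -
    exact (hc h i x z).1
  refine ⟨integrable_of_finite_range Pr hW hm fun b => G b.2,
    (integral_of_finite_range Pr hW hm fun b => G b.2).trans ?_⟩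
  rw [Finset.sum_product]
  refine Finset.sum_eq_zero fun h _ => ?_
  rw [Fintype.sum_sigma]
  refine Finset.sum_eq_zero fun i _ => ?_
  rw [Fintype.sum_prod_type]
  refine Finset.sum_eq_zero fun x _ => ?_
  simp only [(hc h i x _).2, hG, mul_sub, Finset.sum_sub_distrib]
  have e1 : ∀ z, c h i x * P i x z * g i z = c h i x * (P i x z * g i z) := fun z => by ring
  have e2 : ∀ z, c h i x * P i x z * (P i).mulVec (g i) x =
      c h i x * (P i).mulVec (g i) x * P i x z := fun z => by ring
  simp only [e1, e2, ← Finset.mul_sum, hP]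
  simp [Matrix.mulVec, dotProduct]

/-- The centred reward collected by any policy has bounded mean. -/
lemma neg_le_integral_centred (hX : ∀ i, IsMarkovChain Pr (q i) (P i) (X i))
    (hind : iIndepFun (fun i ω => (fun m => X i m ω : ℕ → S i)) Pr) (hP : ∀ i x, ∑ z, P i x z = 1)
    (α : Policy S) (f g : ∀ i, S i → ℝ) (hg : ∀ i x, g i x - (P i).mulVec (g i) x = f i x)
    (n : ℕ) :
    -(2 * ∑ i, ∑ x, |g i x|) ≤
      ∫ ω, ((run α (fun i m => X i m ω) n).map fun e => f e.1 e.2).sum ∂Pr := by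
  let G : (Σ i : Fin K, S i × S i) → ℝ := fun e => g e.1 e.2.2 - (P e.1).mulVec (g e.1) e.2.1
  have hmart := fun k => integral_martingale_increment hX hind hP α g k G fun _ _ _ => rfl
  -- The boundary term evaluates `g` at the state each arm would show next. A play changes it for
  -- one arm only, by g(z) - g(x), and adding f(x) gives g(z) - (P g)(x).
  have hpath : ∀ y : ∀ i, ℕ → S i,
      ((run α y n).map fun e => f e.1 e.2).sum + ∑ i, g i (y i (plays (run α y n) i)) =
        ∑ k ∈ Finset.range n, G (nextStates α y k) + ∑ i, g i (y i 0) := by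
    intro y
    induction n with
    | zero => simp [run, plays]
    | succ n ih =>
      rw [Finset.sum_range_succ, add_right_comm, ← ih]
      set i := α (run α y n) with hi
      have hplays : ∀ j, plays (run α y (n + 1)) j =
          if i = j then plays (run α y n) j + 1 else plays (run α y n) j := by
        intro j
        rw [plays_run_succ]
        split_ifs <;> rfl
      have e1 : ∑ j, g j (y j (plays (run α y (n + 1)) j)) -
          ∑ j, g j (y j (plays (run α y n) j)) =
          g i (y i (plays (run α y n) i + 1)) - g i (y i (plays (run α y n) i)) := by
        rw [← Finset.sum_sub_distrib, Finset.sum_eq_single i]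
        · rw [hplays, if_pos rfl]
        · intro j _ hj
          rw [hplays, if_neg hj.symm, sub_self]
        · simp
      have e2 : ((run α y (n + 1)).map fun e => f e.1 e.2).sum =
          ((run α y n).map fun e => f e.1 e.2).sum + f i (y i (plays (run α y n) i)) := by
        rw [run, List.map_append, List.sum_append, List.map_singleton, List.sum_singleton]
      have e3 : G (nextStates α y n) = g i (y i (plays (run α y n) i + 1)) -
          (P i).mulVec (g i) (y i (plays (run α y n) i)) := rfl
      rw [e2, e3]
      linarith [hg i (y i (plays (run α y n) i))]
  have hbound : ∀ y : ∀ i, ℕ → S i, ∀ t : Fin K → ℕ,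
      |∑ i, g i (y i (t i))| ≤ ∑ i, ∑ x, |g i x| := fun y t =>
    (Finset.abs_sum_le_sum_abs _ _).trans <| Finset.sum_le_sum fun i _ =>
      Finset.single_le_sum (f := fun x => |g i x|) (fun _ _ => abs_nonneg _)
        (Finset.mem_univ (y i (t i)))
  have hint : Integrable (fun ω => ∑ k ∈ Finset.range n,
      G (nextStates α (fun i m => X i m ω) k)) Pr :=
    integrable_finsetSum _ fun k _ => (hmart k).1
  have hzero : ∫ ω, ∑ k ∈ Finset.range n, G (nextStates α (fun i m => X i m ω) k) ∂Pr = 0 := by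
    rw [integral_finsetSum _ fun k _ => (hmart k).1]
    exact Finset.sum_eq_zero fun k _ => (hmart k).2
  calc -(2 * ∑ i, ∑ x, |g i x|)
      = ∫ ω, (∑ k ∈ Finset.range n, G (nextStates α (fun i m => X i m ω) k) -
          2 * ∑ i, ∑ x, |g i x|) ∂Pr := by
        rw [integral_sub hint (integrable_const _), hzero]; simp
    _ ≤ _ := by
      refine integral_mono (hint.sub (integrable_const _))
        (integrable_run hX α n fun h => (h.map fun e => f e.1 e.2).sum) fun ω => ?_
      have h1 := hpath fun i m => X i m ω
      have h2 := (abs_le.1 (hbound (fun i m => X i m ω)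
        fun i => plays (run α (fun i m => X i m ω) n) i)).2
      have h3 := (abs_le.1 (hbound (fun i m => X i m ω) fun i => 0)).1
      simp only at h1 h2 h3 ⊢
      linarith

/-- Regret decomposition for an arbitrary policy. -/
lemma regret_le (hX : ∀ i, IsMarkovChain Pr (q i) (P i) (X i))
    (hind : iIndepFun (fun i ω => (fun m => X i m ω : ℕ → S i)) Pr) (hP : ∀ i x, ∑ z, P i x z = 1)
    (α : Policy S) (r p g : ∀ i, S i → ℝ)
    (hg : ∀ i x, g i x - (P i).mulVec (g i) x = r i x - meanReward r p i) (n : ℕ) :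
    regret Pr r p X α n ≤ ∑ i, (bestMean r p - meanReward r p i) *
        ∫ ω, (plays (run α (fun i m => X i m ω) n) i : ℝ) ∂Pr + 2 * ∑ i, ∑ x, |g i x| := by
  have hcent := neg_le_integral_centred hX hind hP α (fun i x => r i x - meanReward r p i) g hg n
  have hmean : ∀ h : History S, (h.map fun e => meanReward r p e.1).sum =
      ∑ i, meanReward r p i * plays h i := by
    intro h
    induction h using List.reverseRecOn with
    | nil => simp [plays]
    | append_singleton h e ih =>
      simp [plays_append_singleton, mul_add, Finset.sum_add_distrib, ih]
  have htot : ∀ ω, totalReward r (run α (fun i m => X i m ω) n) =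
      ((run α (fun i m => X i m ω) n).map fun e => r e.1 e.2 - meanReward r p e.1).sum +
        ∑ i, meanReward r p i * plays (run α (fun i m => X i m ω) n) i := by
    intro ω
    rw [← hmean, totalReward, ← List.sum_map_add]
    simp
  have hsum : ∑ i, ∫ ω, (plays (run α (fun i m => X i m ω) n) i : ℝ) ∂Pr = n := by
    rw [← integral_finsetSum _ fun i _ => integrable_run hX α n fun h => (plays h i : ℝ)]
    have : ∀ ω, ∑ i, (plays (run α (fun i m => X i m ω) n) i : ℝ) = n := by
      intro ω
      rw [← Nat.cast_sum, sum_plays, length_run]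
    simp [this]
  rw [regret]
  simp only [htot]
  rw [integral_add (integrable_run hX α n fun h =>
      (h.map fun e => r e.1 e.2 - meanReward r p e.1).sum)
    (integrable_finsetSum _ fun i _ =>
      (integrable_run hX α n fun h => (plays h i : ℝ)).const_mul _),
    integral_finsetSum _ fun i _ =>
      (integrable_run hX α n fun h => (plays h i : ℝ)).const_mul _]
  simp only [integral_const_mul, sub_mul, Finset.sum_sub_distrib, ← Finset.mul_sum, hsum]
  rw [mul_comm (n : ℝ)]
  linarith

end Law

/-! ### Plays of suboptimal arms under UCB -/

section UCB

variable {K : ℕ} {S : Fin K → Type*}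

lemma plays_le_length (h : History S) (i : Fin K) : plays h i ≤ h.length :=
  List.countP_le_length

lemma plays_run_mono (α : Policy S) (y : ∀ i, ℕ → S i) (i : Fin K) :
    Monotone fun n => plays (run α y n) i :=
  monotone_nat_of_le_succ fun n => by rw [plays_run_succ]; exact Nat.le_add_right _ _

lemma IsUCB.one_le_plays {r : ∀ i, S i → ℝ} {L : ℝ} {d : ℕ} {α : Policy S}
    (hα : IsUCB r L d α) (y : ∀ i, ℕ → S i) {t : ℕ} (ht : K ≤ t) (i : Fin K) :
    1 ≤ plays (run α y t) i := by
  have h1 : α (run α y i) = i := by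
    rw [hα.1 _ (by rw [length_run]; exact i.2)]
    ext
    exact length_run α y i
  have h2 : 1 ≤ plays (run α y (i + 1)) i := by
    rw [plays_run_succ, if_pos h1]; omega
  exact h2.trans (plays_run_mono α y i (Nat.succ_le_of_lt (i.2.trans_le ht)))

/-- The first `K` rounds give at most `K` plays, and at most `l` plays happen while the count is
below `l`. -/
lemma plays_run_le (α : Policy S) (y : ∀ i, ℕ → S i) (i : Fin K) (l n : ℕ) :
    plays (run α y n) i ≤ K + l + ∑ t ∈ Finset.Ico K n,
      if α (run α y t) = i ∧ l ≤ plays (run α y t) i then 1 else 0 := by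
  induction n with
  | zero => simp [run, plays]
  | succ n ih =>
    rcases Nat.lt_or_ge n K with hn | hn
    · have := plays_le_length (run α y (n + 1)) i
      rw [length_run] at this
      omega
    · rw [Finset.sum_Ico_succ_top hn, plays_run_succ]
      by_cases h1 : α (run α y n) = i
      · by_cases h2 : l ≤ plays (run α y n) i
        · rw [if_pos h1, if_pos ⟨h1, h2⟩]; omega
        · rw [if_pos h1]; omega
      · rw [if_neg h1]; omega

lemma mul_sqrt_div_self {s x : ℝ} (hs : 0 < s) : s * √(x / s) = √(s * x) := by
  rw [← Real.sqrt_sq hs.le, ← Real.sqrt_mul (sq_nonneg s), Real.sqrt_sq hs.le]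
  congr 1
  field_simp

/-- A suboptimal arm that has been played often enough is played again only if its own sample
mean or that of the optimal arm is far from its expectation. -/
lemma IsUCB.exists_deviation {r : ∀ i, S i → ℝ} {L : ℝ} {d : ℕ} {α : Policy S}
    (hα : IsUCB r L d α) (y : ∀ i, ℕ → S i) {i best : Fin K} {μ μs : ℝ} (hμ : μ < μs)
    (hL : 0 ≤ L) {l n t : ℕ} (hl : 4 * L * Real.log n / (μs - μ) ^ 2 ≤ l) (ht : K ≤ t)
    (htn : t + d ≤ n) (hti : α (run α y t) = i) (hpl : l ≤ plays (run α y t) i) :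
    (∃ s ∈ Finset.Icc 1 t,
      √(s * (L * Real.log (t + d : ℕ))) ≤ ∑ k ∈ Finset.range s, (r i (y i k) - μ)) ∨
    (∃ s ∈ Finset.Icc 1 t,
      √(s * (L * Real.log (t + d : ℕ))) ≤
        ∑ k ∈ Finset.range s, (μs - r best (y best k))) := by
  by_contra! hcon
  obtain ⟨h1, h2⟩ := hcon
  have ht1 : 1 ≤ t := (Nat.succ_le_of_lt i.pos).trans ht
  have hs : ∀ j, plays (run α y t) j ∈ Finset.Icc 1 t := fun j => Finset.mem_Icc.2
    ⟨hα.one_le_plays y ht j, by simpa [length_run] using plays_le_length (run α y t) j⟩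
  have hs0 : ∀ j, (0 : ℝ) < plays (run α y t) j := fun j => by
    exact_mod_cast hα.one_le_plays y ht j
  specialize h1 _ (hs i)
  specialize h2 _ (hs best)
  have hidx := hα.2 (run α y t) (by rwa [length_run]) best
  rw [hti, length_run, ucbIndex, ucbIndex, sampleMean_run, sampleMean_run] at hidx
  rw [← mul_sqrt_div_self (hs0 _), Finset.sum_sub_distrib] at h1 h2
  simp only [Finset.sum_const, Finset.card_range, nsmul_eq_mul] at h1 h2
  set si : ℝ := (plays (run α y t) i : ℝ) with hsi
  set sb : ℝ := (plays (run α y t) best : ℝ) with hsb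
  have hi0 : 0 < si := hs0 i
  have hb0 : 0 < sb := hs0 best
  have h1' : (∑ k ∈ Finset.range (plays (run α y t) i), r i (y i k)) / si <
      μ + √(L * Real.log (t + d : ℕ) / si) := by
    rw [div_lt_iff₀ hi0]; linarith
  have h2' : μs - √(L * Real.log (t + d : ℕ) / sb) <
      (∑ k ∈ Finset.range (plays (run α y t) best), r best (y best k)) / sb := by
    rw [lt_div_iff₀ hb0]; linarith
  have hΔ : 0 < μs - μ := sub_pos.2 hμ
  -- Source of the factor 4. Without deviations, arm `i` has index below μ plus two radii, hence
  -- below μs, while the optimal arm has index above μs.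
  have h3 : √(L * Real.log (t + d : ℕ) / si) ≤ (μs - μ) / 2 := by
    refine Real.sqrt_le_iff.2 ⟨by linarith, ?_⟩
    rw [div_le_iff₀ hi0]
    have hlog : Real.log (t + d : ℕ) ≤ Real.log n :=
      Real.log_le_log (by exact_mod_cast (by omega : 0 < t + d)) (by exact_mod_cast htn)
    have h4 : 4 * L * Real.log n ≤ si * (μs - μ) ^ 2 := by
      rw [← div_le_iff₀ (by positivity)]
      exact hl.trans (Nat.cast_le.2 hpl)
    have := mul_le_mul_of_nonneg_left hlog hL
    linarith
  linarith

variable [∀ i, Fintype (S i)] [∀ i, MeasurableSpace (S i)]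
  [∀ i, MeasurableSingletonClass (S i)] {Ω : Type*} [MeasurableSpace Ω] {Pr : Measure Ω}
  {q : ∀ i, S i → ℝ} {P : ∀ i, Matrix (S i) (S i) ℝ}
  {X : ∀ i, ℕ → Ω → S i}

lemma measurableSet_deviation (hX : ∀ i, IsMarkovChain Pr (q i) (P i) (X i)) (i : Fin K)
    (f : S i → ℝ) (u : ℝ) (s : ℕ) :
    MeasurableSet {ω | u ≤ ∑ k ∈ Finset.range s, f (X i k ω)} :=
  measurableSet_le measurable_const <| Finset.measurable_fun_sum _ fun k _ =>
    (measurable_of_finite f).comp ((hX i).measurable k)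

/-- Expected number of plays of a suboptimal arm. -/
lemma IsUCB.integral_plays_le [∀ i, DecidableEq (S i)] [IsProbabilityMeasure Pr]
    (hX : ∀ i, IsMarkovChain Pr (q i) (P i) (X i))
    {p r : ∀ i, S i → ℝ} (hP : ∀ i, IsReversibleChain (P i) (p i)) {L : ℝ} {d : ℕ} (hd : d ≤ 1)
    {α : Policy S} (hα : IsUCB r L d α) {b : ℝ} (hb : 0 < b)
    (hr : ∀ i x, |r i x - meanReward r p i| ≤ b)
    (hL : ∀ i, 90 * b ^ 2 / spectralGap (P i) ≤ L) {i best : Fin K}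
    (hi : meanReward r p i < meanReward r p best) (n : ℕ) :
    ∫ ω, (plays (run α (fun i m => X i m ω) n) i : ℝ) ∂Pr ≤
      K + (4 * L * Real.log n / (meanReward r p best - meanReward r p i) ^ 2 + 1) +
        2 * (∑ j, Real.exp 1 * ∑ x, 1 / √(p j x)) * ∑' t : ℕ, 1 / (t : ℝ) ^ 2 := by
  set A := ∑ j, Real.exp 1 * ∑ x, 1 / √(p j x) with hA
  have hAj : ∀ j, Real.exp 1 * ∑ x, 1 / √(p j x) ≤ A := fun j =>
    Finset.single_le_sum (f := fun j => Real.exp 1 * ∑ x, 1 / √(p j x))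
      (fun j _ => by positivity) (Finset.mem_univ j)
  have hA0 : 0 ≤ A := Finset.sum_nonneg fun j _ => by positivity
  set μ := meanReward r p i with hμ
  set μs := meanReward r p best with hμs
  have hL0 : 0 ≤ L := le_trans (by have := (hP i).spectralGap_pos; positivity) (hL i)
  set l := ⌈4 * L * Real.log n / (μs - μ) ^ 2⌉₊ with hl
  -- These events concern the first `s` states of a single arm, whatever the policy does, so the
  -- tail bound for one chain applies.
  let E : ℕ → ℕ → Set Ω := fun t s => {ω | √(s * (L * Real.log (t + d : ℕ))) ≤
    ∑ k ∈ Finset.range s, (r i (X i k ω) - μ)}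
  let E' : ℕ → ℕ → Set Ω := fun t s => {ω | √(s * (L * Real.log (t + d : ℕ))) ≤
    ∑ k ∈ Finset.range s, (μs - r best (X best k ω))}
  have hmean : ∀ j, ∑ x, p j x * (r j x - meanReward r p j) = 0 := by
    intro j
    simp only [mul_sub, Finset.sum_sub_distrib, ← Finset.sum_mul, (hP j).sum_stationary]
    rw [one_mul, meanReward, sub_eq_zero]
    exact Finset.sum_congr rfl fun x _ => mul_comm _ _
  have hmE : ∀ t s, MeasurableSet (E t s) := fun t s =>
    measurableSet_deviation hX i (fun x => r i x - μ) _ s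
  have hmE' : ∀ t s, MeasurableSet (E' t s) := fun t s =>
    measurableSet_deviation hX best (fun x => μs - r best x) _ s
  have hcube : ∀ t : ℕ, 1 ≤ t → A / ((t + d : ℕ) : ℝ) ^ 3 ≤ A / (t : ℝ) ^ 3 := by
    intro t ht
    have h0 : (0 : ℝ) < t := by exact_mod_cast ht
    have h1 : (t : ℝ) ≤ (t + d : ℕ) := by exact_mod_cast Nat.le_add_right t d
    gcongr
  have hPE : ∀ t s, 1 ≤ t → 1 ≤ s → Pr.real (E t s) ≤ A / (t : ℝ) ^ 3 := by
    intro t s ht hs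
    refine ((hX i).tail_bound (hP i) hb (hr i) (hmean i) (hL i) hs
      (by omega : 1 ≤ t + d)).trans (le_trans ?_ (hcube t ht))
    gcongr
    exact hAj i
  have hPE' : ∀ t s, 1 ≤ t → 1 ≤ s → Pr.real (E' t s) ≤ A / (t : ℝ) ^ 3 := by
    intro t s ht hs
    refine ((hX best).tail_bound (hP best) (f := fun x => μs - r best x) hb
      (fun x => by rw [abs_sub_comm]; exact hr best x) ?_ (hL best) hs
      (by omega : 1 ≤ t + d)).trans (le_trans ?_ (hcube t ht))
    · have h0 := hmean best
      have : ∀ x, p best x * (μs - r best x) = -(p best x * (r best x - μs)) := fun x => by ring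
      rw [Finset.sum_congr rfl fun x _ => this x, Finset.sum_neg_distrib, h0, neg_zero]
    · gcongr
      exact hAj best
  have hpath : ∀ ω, (plays (run α (fun i m => X i m ω) n) i : ℝ) ≤ K + l +
      ∑ t ∈ Finset.Ico K n, ∑ s ∈ Finset.Icc 1 t,
        ((E t s).indicator (fun _ => (1 : ℝ)) ω + (E' t s).indicator (fun _ => (1 : ℝ)) ω) := by
    intro ω
    have h1 := plays_run_le α (fun i m => X i m ω) i l n
    have h2 : (plays (run α (fun i m => X i m ω) n) i : ℝ) ≤ K + l + ∑ t ∈ Finset.Ico K n,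
        if α (run α (fun i m => X i m ω) t) = i ∧ l ≤ plays (run α (fun i m => X i m ω) t) i
          then (1 : ℝ) else 0 := by
      exact_mod_cast h1
    refine h2.trans (add_le_add_right (Finset.sum_le_sum fun t ht => ?_) _)
    rw [Finset.mem_Ico] at ht
    have hnn : ∀ s ∈ Finset.Icc 1 t, 0 ≤ (E t s).indicator (fun _ => (1 : ℝ)) ω +
        (E' t s).indicator (fun _ => (1 : ℝ)) ω := fun s _ =>
      add_nonneg (Set.indicator_nonneg (fun _ _ => zero_le_one) _)
        (Set.indicator_nonneg (fun _ _ => zero_le_one) _)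
    split_ifs with hc
    · rcases hα.exists_deviation (fun i m => X i m ω) (best := best) hi hL0 (Nat.le_ceil _) ht.1
        (by omega) hc.1 hc.2 with ⟨s, hs, hdev⟩ | ⟨s, hs, hdev⟩
      · refine le_trans ?_ (Finset.single_le_sum hnn hs)
        have : (E t s).indicator (fun _ => (1 : ℝ)) ω = 1 :=
          Set.indicator_of_mem (show ω ∈ E t s from hdev) _
        rw [this]
        exact le_add_of_nonneg_right (Set.indicator_nonneg (fun _ _ => zero_le_one) _)
      · refine le_trans ?_ (Finset.single_le_sum hnn hs)
        have : (E' t s).indicator (fun _ => (1 : ℝ)) ω = 1 :=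
          Set.indicator_of_mem (show ω ∈ E' t s from hdev) _
        rw [this]
        exact le_add_of_nonneg_left (Set.indicator_nonneg (fun _ _ => zero_le_one) _)
    · exact Finset.sum_nonneg hnn
  have hintE : ∀ t s, Integrable ((E t s).indicator (fun _ => (1 : ℝ))) Pr := fun t s =>
    (integrable_const _).indicator (hmE t s)
  have hintE' : ∀ t s, Integrable ((E' t s).indicator (fun _ => (1 : ℝ))) Pr := fun t s =>
    (integrable_const _).indicator (hmE' t s)
  have hadd : ∀ t s, Integrable (fun ω => (E t s).indicator (fun _ => (1 : ℝ)) ω +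
      (E' t s).indicator (fun _ => (1 : ℝ)) ω) Pr := fun t s => (hintE t s).add (hintE' t s)
  have hint : ∀ t, Integrable (fun ω => ∑ s ∈ Finset.Icc 1 t,
      ((E t s).indicator (fun _ => (1 : ℝ)) ω + (E' t s).indicator (fun _ => (1 : ℝ)) ω)) Pr :=
    fun t => integrable_finsetSum _ fun s _ => hadd t s
  have hinner : ∀ t, 1 ≤ t → ∫ ω, ∑ s ∈ Finset.Icc 1 t,
      ((E t s).indicator (fun _ => (1 : ℝ)) ω + (E' t s).indicator (fun _ => (1 : ℝ)) ω) ∂Pr ≤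
        2 * A * (1 / (t : ℝ) ^ 2) := by
    intro t ht
    rw [integral_finsetSum _ fun s _ => hadd t s]
    have h0 : (0 : ℝ) < t := by exact_mod_cast ht
    calc _ ≤ ∑ s ∈ Finset.Icc 1 t, (A / (t : ℝ) ^ 3 + A / (t : ℝ) ^ 3) := by
          refine Finset.sum_le_sum fun s hs => ?_
          have hs1 := (Finset.mem_Icc.1 hs).1
          rw [integral_add (hintE t s) (hintE' t s), integral_indicator_const _ (hmE t s),
            integral_indicator_const _ (hmE' t s), smul_eq_mul, smul_eq_mul, mul_one, mul_one]
          exact add_le_add (hPE t s ht hs1) (hPE' t s ht hs1)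
      _ = _ := by
          rw [Finset.sum_const, Nat.card_Icc, nsmul_eq_mul, Nat.add_sub_cancel]
          field_simp
          ring
  have hlle : (l : ℝ) ≤ 4 * L * Real.log n / (μs - μ) ^ 2 + 1 := by
    have hlog := Real.log_natCast_nonneg n
    exact (Nat.ceil_lt_add_one (by positivity)).le
  have htsum : ∑ t ∈ Finset.Ico K n, 1 / (t : ℝ) ^ 2 ≤ ∑' t : ℕ, 1 / (t : ℝ) ^ 2 :=
    (Real.summable_one_div_nat_pow.2 one_lt_two).sum_le_tsum _ fun t _ => by positivity
  calc ∫ ω, (plays (run α (fun i m => X i m ω) n) i : ℝ) ∂Pr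
      ≤ ∫ ω, ((K + l : ℝ) + ∑ t ∈ Finset.Ico K n, ∑ s ∈ Finset.Icc 1 t,
        ((E t s).indicator (fun _ => (1 : ℝ)) ω + (E' t s).indicator (fun _ => (1 : ℝ)) ω)) ∂Pr :=
        integral_mono (integrable_run hX α n fun h => (plays h i : ℝ))
          ((integrable_const _).add (integrable_finsetSum _ fun t _ => hint t)) hpath
    _ = K + l + ∑ t ∈ Finset.Ico K n, ∫ ω, ∑ s ∈ Finset.Icc 1 t,
        ((E t s).indicator (fun _ => (1 : ℝ)) ω +
          (E' t s).indicator (fun _ => (1 : ℝ)) ω) ∂Pr := by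
        rw [integral_add (integrable_const _) (integrable_finsetSum _ fun t _ => hint t),
          integral_finsetSum _ fun t _ => hint t]
        simp
    _ ≤ K + l + ∑ t ∈ Finset.Ico K n, 2 * A * (1 / (t : ℝ) ^ 2) :=
        add_le_add_right (Finset.sum_le_sum fun t ht =>
          hinner t ((Nat.succ_le_of_lt i.pos).trans (Finset.mem_Ico.1 ht).1)) _
    _ ≤ _ := by
        rw [← Finset.mul_sum]
        have := mul_le_mul_of_nonneg_left htsum (mul_nonneg zero_le_two hA0)
        linarith

end UCB

/-! ### The constants -/

section ConstantBounds

variable {K : ℕ} {S : Fin K → Type*} [∀ i, Fintype (S i)]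

lemma le_maxOver (f : ∀ i, S i → ℝ) (i : Fin K) (x : S i) : f i x ≤ maxOver f :=
  le_ciSup (f := fun e : Σ i, S i => f e.1 e.2) (Set.finite_range _).bddAbove ⟨i, x⟩

lemma meanReward_le_bestMean (r p : ∀ i, S i → ℝ) (i : Fin K) :
    meanReward r p i ≤ bestMean r p :=
  le_ciSup (f := fun i => meanReward r p i) (Set.finite_range _).bddAbove i

variable [∀ i, DecidableEq (S i)] {P : ∀ i, Matrix (S i) (S i) ℝ} {p r : ∀ i, S i → ℝ}

lemma constD_nonneg (hP : ∀ i, IsReversibleChain (P i) (p i)) (hr : ∀ i x, 0 < r i x)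
    (L : ℝ) (i : Fin K) : 0 ≤ constD P r p L i := by
  have h1 : 0 ≤ minOver p := Real.iInf_nonneg fun e => ((hP e.1).stationary_pos e.2).le
  have h2 : 0 ≤ minOver r := Real.iInf_nonneg fun e => (hr e.1 e.2).le
  have h3 : 0 ≤ gapMax P := Real.iSup_nonneg fun i => (hP i).spectralGap_pos.le
  unfold constD
  positivity

lemma constC_nonneg (hP : ∀ i, IsReversibleChain (P i) (p i)) (hr : ∀ i x, 0 < r i x)
    (L : ℝ) (best i : Fin K) : 0 ≤ constC P r p L best i := by
  have h1 := constD_nonneg hP hr L i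
  have h2 := constD_nonneg hP hr L best
  have h3 : 0 ≤ ∑' t : ℕ, 1 / ((t : ℝ) + 1) ^ 2 := tsum_nonneg fun t => by positivity
  unfold constC
  positivity

lemma abs_reward_sub_mean_le (hP : ∀ i, IsReversibleChain (P i) (p i)) (hr : ∀ i x, 0 < r i x)
    (i : Fin K) (x : S i) : |r i x - meanReward r p i| ≤ maxOver r := by
  have h1 : 0 ≤ meanReward r p i := Finset.sum_nonneg fun z _ =>
    mul_nonneg (hr i z).le ((hP i).stationary_pos z).le
  have h2 : meanReward r p i ≤ maxOver r := by
    calc meanReward r p i ≤ ∑ z, maxOver r * p i z := Finset.sum_le_sum fun z _ =>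
          mul_le_mul_of_nonneg_right (le_maxOver r i z) ((hP i).stationary_pos z).le
      _ = maxOver r := by rw [← Finset.mul_sum, (hP i).sum_stationary, mul_one]
  have h3 := hr i x
  have h4 := le_maxOver r i x
  exact abs_le.2 ⟨by linarith, by linarith⟩

/-- The concentration bound needs no factor `maxCard S ^ 2`; it is at least 1, so the assumed bound
on L is stronger. -/
lemma exploration_bound (hP : ∀ i, IsReversibleChain (P i) (p i)) (i : Fin K) :
    90 * maxOver r ^ 2 / spectralGap (P i) ≤
      90 * maxCard S ^ 2 * maxOver r ^ 2 / gapMin P := by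
  have : Nonempty (Fin K) := ⟨i⟩
  have h1 : gapMin P ≤ spectralGap (P i) :=
    ciInf_le (f := fun i => spectralGap (P i)) (Set.finite_range _).bddBelow i
  have h2 : 0 < gapMin P := by
    obtain ⟨j, hj⟩ := exists_eq_ciInf_of_finite (f := fun i => spectralGap (P i))
    rw [gapMin, ← hj]
    exact (hP j).spectralGap_pos
  have h3 : 1 ≤ maxCard S := by
    have := (hP i).nonempty
    refine le_trans ?_ (le_ciSup (f := fun i => (Fintype.card (S i) : ℝ))
      (Set.finite_range _).bddAbove i)
    exact_mod_cast Fintype.card_pos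
  have h4 : 1 ≤ maxCard S ^ 2 := one_le_pow₀ h3
  have h5 : 90 * maxOver r ^ 2 ≤ 90 * maxCard S ^ 2 * maxOver r ^ 2 := by
    nlinarith [sq_nonneg (maxOver r)]
  gcongr

end ConstantBounds

end RestedBandit

theorem theorem1 {K : ℕ} {S : Fin K → Type*} [∀ i, Fintype (S i)] [∀ i, DecidableEq (S i)]
    [∀ i, MeasurableSpace (S i)] [∀ i, MeasurableSingletonClass (S i)]
    (P : ∀ i, Matrix (S i) (S i) ℝ) (p : ∀ i, S i → ℝ) (r : ∀ i, S i → ℝ)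
    (hP : ∀ i, P i ∈ Matrix.rowStochastic ℝ (S i))
    (hirr : ∀ i, (P i).IsIrreducible)
    (haper : ∀ i, RestedBandit.IsAperiodic (P i))
    (hstat : ∀ i, RestedBandit.IsStationary (P i) (p i))
    (hrev : ∀ i, RestedBandit.IsReversible (P i) (p i))
    (hr : ∀ i x, 0 < r i x) :
    -- the constant depends on the state spaces, transition matrices and rewards only
    ∃ C : ℝ,
      ∀ (L : ℝ),
        90 * RestedBandit.maxCard S ^ 2 * RestedBandit.maxOver r ^ 2 / RestedBandit.gapMin P ≤ L →
      ∀ (d : ℕ), d ≤ 1 →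
      ∀ (α : RestedBandit.Policy S), RestedBandit.IsUCB r L d α →
      ∀ {Ω : Type*} [MeasurableSpace Ω] (Pr : Measure Ω) [IsProbabilityMeasure Pr]
        (q : ∀ i, S i → ℝ) (X : ∀ i, ℕ → Ω → S i),
        (∀ i, RestedBandit.IsMarkovChain Pr (q i) (P i) (X i)) →
        iIndepFun (fun i ω => (fun m => X i m ω : ℕ → S i)) Pr →
      ∀ (best : Fin K),
        RestedBandit.meanReward r p best = RestedBandit.bestMean r p →
      ∀ (n : ℕ), 1 ≤ n →
        RestedBandit.regret Pr r p X α n ≤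
          4 * L * ∑ i with RestedBandit.meanReward r p i < RestedBandit.bestMean r p,
              Real.log n / (RestedBandit.bestMean r p - RestedBandit.meanReward r p i)
          + ∑ i with RestedBandit.meanReward r p i < RestedBandit.bestMean r p,
              (RestedBandit.bestMean r p - RestedBandit.meanReward r p i) *
                RestedBandit.constC P r p L best i
          + C := by
  have hch : ∀ i, RestedBandit.IsReversibleChain (P i) (p i) := fun i =>
    ⟨hP i, hirr i, hstat i, hrev i⟩
  have hpoisson : ∀ i, ∃ g : S i → ℝ, ∀ x,
      g x - (P i).mulVec g x = r i x - RestedBandit.meanReward r p i := by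
    intro i
    refine (hch i).exists_poisson _ ?_
    simp only [mul_sub, Finset.sum_sub_distrib, ← Finset.sum_mul, (hch i).sum_stationary]
    rw [one_mul, RestedBandit.meanReward, sub_eq_zero]
    exact Finset.sum_congr rfl fun x _ => mul_comm _ _
  choose g hg using hpoisson
  -- All of the bound on the expected plays except its logarithmic term; it is independent of L, as
  -- C must be. The term t = 0 of the series is 1 / 0 = 0.
  set B : ℝ := K + 1 + 2 * (∑ j, Real.exp 1 * ∑ x, 1 / √(p j x)) * ∑' t : ℕ, 1 / (t : ℝ) ^ 2
    with hB
  refine ⟨∑ i with RestedBandit.meanReward r p i < RestedBandit.bestMean r p,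
    (RestedBandit.bestMean r p - RestedBandit.meanReward r p i) * B + 2 * ∑ i, ∑ x, |g i x|, ?_⟩
  intro L hL d hd α hα Ω _ Pr _ q X hX hind best hbest n _
  have hb : 0 < RestedBandit.maxOver r := by
    obtain ⟨x⟩ := (hch best).nonempty
    exact (hr best x).trans_le (RestedBandit.le_maxOver r best x)
  refine (RestedBandit.regret_le hX hind (fun i => (hch i).sum_row) α r p g hg n).trans ?_
  rw [← add_assoc]
  refine add_le_add_left ?_ _
  rw [Finset.mul_sum, ← Finset.sum_add_distrib, ← Finset.sum_add_distrib, Finset.sum_filter]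
  refine Finset.sum_le_sum fun i _ => ?_
  split_ifs with hi
  · have hΔ : 0 < RestedBandit.bestMean r p - RestedBandit.meanReward r p i := sub_pos.2 hi
    have hplays := hα.integral_plays_le hX hch hd hb
      (RestedBandit.abs_reward_sub_mean_le hch hr)
      (fun j => (RestedBandit.exploration_bound hch j).trans hL)
      (by rw [hbest]; exact hi : RestedBandit.meanReward r p i < RestedBandit.meanReward r p best) n
    rw [hbest] at hplays
    have hC := mul_nonneg hΔ.le (RestedBandit.constC_nonneg hch hr L best i)
    have h1 := mul_le_mul_of_nonneg_left hplays hΔ.le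
    refine h1.trans ?_
    have h2 : (RestedBandit.bestMean r p - RestedBandit.meanReward r p i) *
        (4 * L * Real.log n / (RestedBandit.bestMean r p - RestedBandit.meanReward r p i) ^ 2) =
        4 * L * (Real.log n / (RestedBandit.bestMean r p - RestedBandit.meanReward r p i)) := by
      field_simp
    rw [hB]
    linarith
  -- Optimal arms contribute nothing, however often they are played.
  · have : RestedBandit.bestMean r p - RestedBandit.meanReward r p i = 0 := by
      linarith [RestedBandit.meanReward_le_bestMean r p i]
    rw [this, zero_mul]
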